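/- \textbf{Setting.} Let $\overline M$ be a smooth manifold with a Riemannian metric $g$, Levi-Civita connection $\overline\nabla$, and a smooth $(1,1)$-tensor field $\varphi$ such that, for a fixed $\epsilon\in\{-1,1\}$, $g(\varphi X,Y)=\epsilon\, g(X,\varphi Y)$ for all vector fields $X,Y$, and either $\varphi^2=\epsilon I$, or $\varphi^2=\epsilon(I-\eta\otimes\xi)$ for a smooth unit vector field $\xi$ with dual form $\eta=g(\xi,\cdot)$. Let $M$ be $\overline M$ or an immersed submanifold of $\overline M$, with $\xi$ tangent to $M$ in the second case. $TM$ denotes the smooth vector fields on $M$; distributions are smooth, and regular means of constant dimension. For a distribution $D$ on $M$ and a vector field $Z$ along $M$, tangent to $\overline M$, let $fZ$ be the orthogonal projection of $\varphi Z$ onto $D$. A \emph{$k$-pointwise slant distribution} ($k\ge 1$) is a distribution with an orthogonal decomposition $D=\oplus_{i=0}^k D_i$ into regular distributions, where $D_1,\dots,D_k$ are non-null, together with $k$ distinct continuous functions $\theta_i:M\to(0,\frac\pi2]$, such that: for $1\le i\le k$, $x\in M$ and $0\ne v\in (D_i)_x$, $\varphi v\neq0$ and the angle between $\varphi v$ and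 $(D_i)_x$ is $\theta_i(x)$; $\varphi D_0\subseteq D_0$; and $fD_i\subseteq D_i$ for $1\le i\le k$. A \emph{$k$-slant distribution} is a distribution admitting such a decomposition in which the $\theta_i$ are distinct constants. \textbf{Theorem.} Let $D=\oplus_{i=0}^kD_i$ be a $k$-pointwise slant distribution on $M$, orthogonal to $\xi$ in the second case, and assume that $\overline\nabla_XY\in D$ for all $X\in TM$ and $Y\in\oplus_{i=1}^kD_i$. Then for $1\le i\le k$ and $x\in M$ the restriction of $f^2$ to $(D_i)_x$ has exactly one eigenvalue $\lambda_i(x)$, and $(D_i)_x$ consists of eigenvectors of it. Moreover: (A) The following are equivalent: 1) $(\overline\nabla_Xf^2)Y:=\overline\nabla_X(f^2Y)-f^2(\overline\nabla_XY)=0$ for all $X\in TM$ and $Y\in\oplus_{i=1}^kD_i$; 2) (i) $f^2(\overline\nabla_XY)=\lambda_i\overline\nabla_XY$ for all $X\in TM$, $Y\in D_i$, $1\le i\le k$; and (ii) the restriction of $D$ to any connected component $C$ of $M$ is a $k'$-slant distribution for some $k'\in\{1,\dots,k\}$ (depending on $C$). For each component $C$, the condition in (ii) holds if and only if $\lambda_1,\dots,\lambda_k$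 are constant on $C$, and $k'$ is then the number of distinct values among $\lambda_1,\dots,\lambda_k$ on $C$. (B) If $M$ is connected, the following are equivalent: 1) $(\overline\nabla_Xf^2)Y=0$ for all $X\in TM$ and $Y\in\oplus_{i=1}^kD_i$; 2) (i) $f^2(\overline\nabla_XY)=\lambda_i\overline\nabla_XY$ for all $X\in TM$, $Y\in D_i$, $1\le i\le k$; and (ii) $D$ is a $k$-slant distribution. Condition (ii) of (B) holds if and only if $\lambda_1,\dots,\lambda_k$ are constant and pairwise different on $M$. -/

import Mathlib

open Bundle
open scoped Manifold ContDiff InnerProductSpace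

noncomputable section

namespace KSlant

/-! ### The Levi-Civita connection along a smooth map

`Mb` is a smooth manifold modelled on the finite-dimensional space `E`, with a Riemannian metric. -/

section LeviCivita

variable {E : Type*} [NormedAddCommGroup E] [NormedSpace ℝ E] [FiniteDimensional ℝ E]
  {Mb : Type*} [TopologicalSpace Mb] [ChartedSpace E Mb]

instance finiteDimensional_tangentSpace (p : Mb) :
    FiniteDimensional ℝ (TangentSpace 𝓘(ℝ, E) p) :=
  inferInstanceAs (FiniteDimensional ℝ E)

variable [IsManifold 𝓘(ℝ, E) ∞ Mb]

/-- Components of a tangent vector at `q` in the chart centred at `p`. -/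
def coords (p q : Mb) : TangentSpace 𝓘(ℝ, E) q →L[ℝ] E :=
  (trivializationAt E (TangentSpace 𝓘(ℝ, E)) p).continuousLinearMapAt ℝ q

/-- The coordinate vector field of the chart centred at `p` with constant components `u`. -/
def coordField (p : Mb) (u : E) (q : Mb) : TangentSpace 𝓘(ℝ, E) q :=
  (trivializationAt E (TangentSpace 𝓘(ℝ, E)) p).symmL ℝ q u

variable [RiemannianBundle (fun p : Mb => TangentSpace 𝓘(ℝ, E) p)]

/-- The component function `g(∂_u, ∂_v)` of the metric in the chart centred at `p`. -/
def metricCoeff (p : Mb) (u v : E) (q : Mb) : ℝ :=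
  ⟪coordField p u q, coordField p v q⟫_ℝ

/-- The derivative `∂_w (g(∂_u, ∂_v))` at the centre `p` of the chart. -/
def metricCoeffDeriv (p : Mb) (w u v : E) : ℝ :=
  mfderiv 𝓘(ℝ, E) 𝓘(ℝ, ℝ) (metricCoeff p u v) p (coordField p w p)

/-- The Christoffel symbol of the first kind
`½ (∂_u g(∂_v, ∂_w) + ∂_v g(∂_u, ∂_w) - ∂_w g(∂_u, ∂_v))` at the centre `p` of the chart. -/
def christoffelFirst (p : Mb) (u v w : E) : ℝ :=
  (metricCoeffDeriv p u v w + metricCoeffDeriv p v u w - metricCoeffDeriv p w u v) / 2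

/-- The Christoffel symbol of the second kind `Γ(u, v)` at the centre `p` of the chart: the tangent
vector with `g(Γ(u, v), ∂_w) = christoffelFirst p u v w` for all `w`, written out in an orthonormal
basis of the tangent space. -/
def christoffel (p : Mb) (u v : E) : TangentSpace 𝓘(ℝ, E) p :=
  ∑ j, christoffelFirst p u v
      (coords p p (stdOrthonormalBasis ℝ (TangentSpace 𝓘(ℝ, E) p) j)) •
    stdOrthonormalBasis ℝ (TangentSpace 𝓘(ℝ, E) p) j

variable {F : Type*} [NormedAddCommGroup F] [NormedSpace ℝ F]
  {M : Type*} [TopologicalSpace M] [ChartedSpace F M]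

/-- The Levi-Civita covariant derivative of a vector field `V` along `ι : M → Mb`
(`V x` is tangent to `Mb` at `ι x`), in the direction of `a`, a tangent vector of `M` at `x`:
in the chart of `Mb` centred at `ι x`, its components are `dV(a) + Γ(dι a, V)`. -/
def covDerivAlong (ι : M → Mb) (V : ∀ x : M, TangentSpace 𝓘(ℝ, E) (ι x)) (x : M)
    (a : TangentSpace 𝓘(ℝ, F) x) : TangentSpace 𝓘(ℝ, E) (ι x) :=
  coordField (E := E) (ι x) (mfderiv 𝓘(ℝ, F) 𝓘(ℝ, E) (fun y => coords (ι x) (ι y) (V y)) x a) (ι x) +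
    christoffel (E := E) (ι x) (coords (ι x) (ι x) (mfderiv 𝓘(ℝ, F) 𝓘(ℝ, E) ι x a))
      (coords (ι x) (ι x) (V x))

end LeviCivita

/-! ### Vector fields and distributions -/

section Distributions

variable {F : Type*} [NormedAddCommGroup F] [NormedSpace ℝ F]
  {M : Type*} [TopologicalSpace M] [ChartedSpace F M] [IsManifold 𝓘(ℝ, F) ∞ M]

/-- `X` is smooth on `U` as a vector field on `M`. -/
def SmoothFieldOn (U : Set M) (X : ∀ x : M, TangentSpace 𝓘(ℝ, F) x) : Prop :=
  ContMDiffOn 𝓘(ℝ, F) (𝓘(ℝ, F)).tangent ∞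
    (fun x => (⟨x, X x⟩ : TangentBundle 𝓘(ℝ, F) M)) U

/-- `X` is a smooth vector field on `M`. -/
def SmoothField (X : ∀ x : M, TangentSpace 𝓘(ℝ, F) x) : Prop :=
  SmoothFieldOn Set.univ X

/-- `D` is a smooth regular distribution (a smooth distribution of constant dimension) on the
open set `U`. The dimension may be `0`. -/
def IsRegularDistributionOn (U : Set M) (D : ∀ x : M, Submodule ℝ (TangentSpace 𝓘(ℝ, F) x)) :
    Prop :=
  ∃ r : ℕ, ∀ x ∈ U, ∃ N : Set M, IsOpen N ∧ x ∈ N ∧ N ⊆ U ∧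
    ∃ V : Fin r → ∀ y : M, TangentSpace 𝓘(ℝ, F) y, (∀ j, SmoothFieldOn N (V j)) ∧
      ∀ y ∈ N, LinearIndependent ℝ (fun j => V j y) ∧
        Submodule.span ℝ (Set.range fun j => V j y) = D y

/-- `D` is not the null distribution on `U`. -/
def IsNonNullOn (U : Set M) (D : ∀ x : M, Submodule ℝ (TangentSpace 𝓘(ℝ, F) x)) : Prop :=
  ∃ x ∈ U, D x ≠ ⊥

/-- The whole distribution `D = D₀ ⊕ D₁ ⊕ ⋯ ⊕ D_k`. -/
def total {k : ℕ} (D : Fin (k + 1) → ∀ x : M, Submodule ℝ (TangentSpace 𝓘(ℝ, F) x)) (x : M) :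
    Submodule ℝ (TangentSpace 𝓘(ℝ, F) x) :=
  ⨆ i, D i x

/-- The component `D₁ ⊕ ⋯ ⊕ D_k`. -/
def proper {k : ℕ} (D : Fin (k + 1) → ∀ x : M, Submodule ℝ (TangentSpace 𝓘(ℝ, F) x)) (x : M) :
    Submodule ℝ (TangentSpace 𝓘(ℝ, F) x) :=
  ⨆ i : Fin k, D i.succ x

end Distributions

/-! ### Slant distributions

`M` is immersed in the Riemannian manifold `Mb` by `ι`, and `φ` is a `(1,1)`-tensor field on `Mb`.
Distributions on `M` are families of subspaces of the tangent spaces of `M`; they are regarded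
inside the tangent spaces of `Mb` through `dι`. -/

section Slant

/-- The angle in `[0, π/2]` between a nonzero vector and a subspace: the angle with the orthogonal
projection onto the subspace (`π/2` if the projection vanishes). -/
def angleSubspace {T : Type*} [NormedAddCommGroup T] [InnerProductSpace ℝ T]
    [FiniteDimensional ℝ T] (u : T) (W : Submodule ℝ T) : ℝ :=
  InnerProductGeometry.angle u (W.starProjection u)

variable {E : Type*} [NormedAddCommGroup E] [NormedSpace ℝ E] [FiniteDimensional ℝ E]
  {Mb : Type*} [TopologicalSpace Mb] [ChartedSpace E Mb] [IsManifold 𝓘(ℝ, E) ∞ Mb]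
  [RiemannianBundle (fun p : Mb => TangentSpace 𝓘(ℝ, E) p)]
  {F : Type*} [NormedAddCommGroup F] [NormedSpace ℝ F]
  {M : Type*} [TopologicalSpace M] [ChartedSpace F M] [IsManifold 𝓘(ℝ, F) ∞ M]

/-- A tangent vector of `M` as a tangent vector of `Mb`. -/
def push (E : Type*) [NormedAddCommGroup E] [NormedSpace ℝ E] {Mb : Type*} [TopologicalSpace Mb]
    [ChartedSpace E Mb] (ι : M → Mb) (x : M) :
    TangentSpace 𝓘(ℝ, F) x →L[ℝ] TangentSpace 𝓘(ℝ, E) (ι x) :=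
  mfderiv 𝓘(ℝ, F) 𝓘(ℝ, E) ι x

/-- A subspace of the tangent space of `M` as a subspace of the tangent space of `Mb`. -/
def pushSub (E : Type*) [NormedAddCommGroup E] [NormedSpace ℝ E] {Mb : Type*} [TopologicalSpace Mb]
    [ChartedSpace E Mb] (ι : M → Mb) (x : M) (W : Submodule ℝ (TangentSpace 𝓘(ℝ, F) x)) :
    Submodule ℝ (TangentSpace 𝓘(ℝ, E) (ι x)) :=
  W.map (push E ι x).toLinearMap

/-- `f`, the component of `φ` into the distribution `D` (orthogonal projection of `φ` onto `D`). -/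
def comp (φ : ∀ p : Mb, TangentSpace 𝓘(ℝ, E) p →L[ℝ] TangentSpace 𝓘(ℝ, E) p) (ι : M → Mb)
    (D : ∀ x : M, Submodule ℝ (TangentSpace 𝓘(ℝ, F) x)) (x : M)
    (v : TangentSpace 𝓘(ℝ, E) (ι x)) : TangentSpace 𝓘(ℝ, E) (ι x) :=
  (pushSub E ι x (D x)).starProjection (φ (ι x) v)

/-- `D` is a `θ`-pointwise slant distribution on `U` (non-nullness is not included). -/
def IsPointwiseSlantOn (φ : ∀ p : Mb, TangentSpace 𝓘(ℝ, E) p →L[ℝ] TangentSpace 𝓘(ℝ, E) p)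
    (ι : M → Mb) (U : Set M) (D : ∀ x : M, Submodule ℝ (TangentSpace 𝓘(ℝ, F) x)) (θ : M → ℝ) :
    Prop :=
  ContinuousOn θ U ∧ ∀ x ∈ U, θ x ∈ Set.Ioc 0 (Real.pi / 2) ∧
    ∀ v ∈ D x, v ≠ 0 → φ (ι x) (push E ι x v) ≠ 0 ∧
      angleSubspace (φ (ι x) (push E ι x v)) (pushSub E ι x (D x)) = θ x

/-- `D` is a slant distribution on `U` with slant angle `θ` (non-nullness is not included). -/
def IsSlantOn (φ : ∀ p : Mb, TangentSpace 𝓘(ℝ, E) p →L[ℝ] TangentSpace 𝓘(ℝ, E) p)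
    (ι : M → Mb) (U : Set M) (D : ∀ x : M, Submodule ℝ (TangentSpace 𝓘(ℝ, F) x)) (θ : ℝ) :
    Prop :=
  θ ∈ Set.Ioc 0 (Real.pi / 2) ∧
    ∀ x ∈ U, ∀ v ∈ D x, v ≠ 0 → φ (ι x) (push E ι x v) ≠ 0 ∧
      angleSubspace (φ (ι x) (push E ι x v)) (pushSub E ι x (D x)) = θ

/-- What the definitions of `k`-slant and `k`-pointwise slant distributions have in common: on `U`,
`D = D₀ ⊕ D₁ ⊕ ⋯ ⊕ D_k` is an orthogonal decomposition into regular distributions with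
`D₁, …, D_k` non-null, `φ D₀ ⊆ D₀`, and `f Dᵢ ⊆ Dᵢ` for `i ≥ 1`. -/
structure IsDecompositionOn
    (φ : ∀ p : Mb, TangentSpace 𝓘(ℝ, E) p →L[ℝ] TangentSpace 𝓘(ℝ, E) p) (ι : M → Mb)
    (U : Set M) {k : ℕ} (D : Fin (k + 1) → ∀ x : M, Submodule ℝ (TangentSpace 𝓘(ℝ, F) x)) :
    Prop where
  regular : ∀ i, IsRegularDistributionOn U (D i)
  nonNull : ∀ i : Fin k, IsNonNullOn U (D i.succ)
  orthogonal : ∀ i j, i ≠ j → ∀ x ∈ U, ∀ v ∈ D i x, ∀ w ∈ D j x,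
    ⟪push E ι x v, push E ι x w⟫_ℝ = 0
  invariant : ∀ x ∈ U, ∀ v ∈ D 0 x, φ (ι x) (push E ι x v) ∈ pushSub E ι x (D 0 x)
  component : ∀ i : Fin k, ∀ x ∈ U, ∀ v ∈ D i.succ x,
    comp φ ι (total D) x (push E ι x v) ∈ pushSub E ι x (D i.succ x)

/-- `D = D₀ ⊕ D₁ ⊕ ⋯ ⊕ D_k` is a `k`-pointwise slant distribution on `M` with invariant component
`D₀` and slant functions `θ₁, …, θ_k`, which are distinct as functions. -/
structure IsKPointwiseSlant
    (φ : ∀ p : Mb, TangentSpace 𝓘(ℝ, E) p →L[ℝ] TangentSpace 𝓘(ℝ, E) p) (ι : M → Mb)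
    {k : ℕ} (D : Fin (k + 1) → ∀ x : M, Submodule ℝ (TangentSpace 𝓘(ℝ, F) x))
    (θ : Fin k → M → ℝ) : Prop where
  pos : 1 ≤ k
  decomposition : IsDecompositionOn φ ι Set.univ D
  slant : ∀ i : Fin k, IsPointwiseSlantOn φ ι Set.univ (D i.succ) (θ i)
  distinct : Function.Injective θ

/-- The distribution `Δ` is, on the open set `U`, a `k`-slant distribution: it has an orthogonal
decomposition `D₀ ⊕ D₁ ⊕ ⋯ ⊕ D_k` with invariant component `D₀` and components `D₁, …, D_k` that are
slant with distinct slant angles `θ₁, …, θ_k`. -/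
def IsKSlantOn (φ : ∀ p : Mb, TangentSpace 𝓘(ℝ, E) p →L[ℝ] TangentSpace 𝓘(ℝ, E) p)
    (ι : M → Mb) (U : Set M) (k : ℕ) (Δ : ∀ x : M, Submodule ℝ (TangentSpace 𝓘(ℝ, F) x)) :
    Prop :=
  1 ≤ k ∧ ∃ (D : Fin (k + 1) → ∀ x : M, Submodule ℝ (TangentSpace 𝓘(ℝ, F) x)) (θ : Fin k → ℝ),
    (∀ x ∈ U, total D x = Δ x) ∧ IsDecompositionOn φ ι U D ∧
    (∀ i : Fin k, IsSlantOn φ ι U (D i.succ) (θ i)) ∧ Function.Injective θ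

/-- `μ i x` is the only eigenvalue of `f²` on the subspace `(Dᵢ)ₓ`, and `(Dᵢ)ₓ` consists of
eigenvectors of it (`i = 1, …, k`). These conditions determine `μ`. -/
def AreEigenvalueFunctions
    (φ : ∀ p : Mb, TangentSpace 𝓘(ℝ, E) p →L[ℝ] TangentSpace 𝓘(ℝ, E) p) (ι : M → Mb)
    {k : ℕ} (D : Fin (k + 1) → ∀ x : M, Submodule ℝ (TangentSpace 𝓘(ℝ, F) x))
    (μ : Fin k → M → ℝ) : Prop :=
  ∀ (i : Fin k) (x : M),
    (∀ c : ℝ, (∃ v ∈ D i.succ x, v ≠ 0 ∧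
      comp φ ι (total D) x (comp φ ι (total D) x (push E ι x v)) = c • push E ι x v) ↔ c = μ i x) ∧
    ∀ v ∈ D i.succ x,
      comp φ ι (total D) x (comp φ ι (total D) x (push E ι x v)) = μ i x • push E ι x v

/-- The Levi-Civita derivative `∇_X Y` along `M`, for vector fields `X`, `Y` on `M`. -/
def nabla (E : Type*) [NormedAddCommGroup E] [NormedSpace ℝ E] [FiniteDimensional ℝ E]
    {Mb : Type*} [TopologicalSpace Mb] [ChartedSpace E Mb] [IsManifold 𝓘(ℝ, E) ∞ Mb]
    [RiemannianBundle (fun p : Mb => TangentSpace 𝓘(ℝ, E) p)] (ι : M → Mb)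
    (X Y : ∀ x : M, TangentSpace 𝓘(ℝ, F) x) (x : M) : TangentSpace 𝓘(ℝ, E) (ι x) :=
  covDerivAlong ι (fun y => push E ι y (Y y)) x (X x)

/-- `(∇_X f²) Y = ∇_X (f² Y) - f² (∇_X Y)`, where `f` is the component of `φ` into `Δ`. -/
def nablaSq (φ : ∀ p : Mb, TangentSpace 𝓘(ℝ, E) p →L[ℝ] TangentSpace 𝓘(ℝ, E) p) (ι : M → Mb)
    (Δ : ∀ x : M, Submodule ℝ (TangentSpace 𝓘(ℝ, F) x))
    (X Y : ∀ x : M, TangentSpace 𝓘(ℝ, F) x) (x : M) : TangentSpace 𝓘(ℝ, E) (ι x) :=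
  covDerivAlong ι (fun y => comp φ ι Δ y (comp φ ι Δ y (push E ι y (Y y)))) x (X x) -
    comp φ ι Δ x (comp φ ι Δ x (nabla E ι X Y x))

/-- `∇_X Y ∈ D` for all smooth vector fields `X` on `M` and `Y ∈ D₁ ⊕ ⋯ ⊕ D_k`. -/
def NablaPreserves (E : Type*) [NormedAddCommGroup E] [NormedSpace ℝ E] [FiniteDimensional ℝ E]
    {Mb : Type*} [TopologicalSpace Mb] [ChartedSpace E Mb] [IsManifold 𝓘(ℝ, E) ∞ Mb]
    [RiemannianBundle (fun p : Mb => TangentSpace 𝓘(ℝ, E) p)] (ι : M → Mb)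
    {k : ℕ} (D : Fin (k + 1) → ∀ x : M, Submodule ℝ (TangentSpace 𝓘(ℝ, F) x)) : Prop :=
  ∀ X Y : ∀ x : M, TangentSpace 𝓘(ℝ, F) x, SmoothField X → SmoothField Y →
    (∀ x, Y x ∈ proper D x) → ∀ x, nabla E ι X Y x ∈ pushSub E ι x (total D x)

/-- `(∇_X f²) Y = 0` for all smooth vector fields `X` on `M` and `Y ∈ D₁ ⊕ ⋯ ⊕ D_k`. -/
def NablaSqVanishes (φ : ∀ p : Mb, TangentSpace 𝓘(ℝ, E) p →L[ℝ] TangentSpace 𝓘(ℝ, E) p)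
    (ι : M → Mb) {k : ℕ} (D : Fin (k + 1) → ∀ x : M, Submodule ℝ (TangentSpace 𝓘(ℝ, F) x)) :
    Prop :=
  ∀ X Y : ∀ x : M, TangentSpace 𝓘(ℝ, F) x, SmoothField X → SmoothField Y →
    (∀ x, Y x ∈ proper D x) → ∀ x, nablaSq φ ι (total D) X Y x = 0

/-- `f² (∇_X Y) = μᵢ ∇_X Y` for all smooth vector fields `X` on `M` and `Y ∈ Dᵢ`,
`i = 1, …, k`. -/
def NablaEigen (φ : ∀ p : Mb, TangentSpace 𝓘(ℝ, E) p →L[ℝ] TangentSpace 𝓘(ℝ, E) p)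
    (ι : M → Mb) {k : ℕ} (D : Fin (k + 1) → ∀ x : M, Submodule ℝ (TangentSpace 𝓘(ℝ, F) x))
    (μ : Fin k → M → ℝ) : Prop :=
  ∀ (i : Fin k) (X Y : ∀ x : M, TangentSpace 𝓘(ℝ, F) x), SmoothField X → SmoothField Y →
    (∀ x, Y x ∈ D i.succ x) → ∀ x,
      comp φ ι (total D) x (comp φ ι (total D) x (nabla E ι X Y x)) = μ i x • nabla E ι X Y x

/-- The structural assumptions on `(Mb, φ, g)`, `M` and `Δ`: either `φ² = ε I`, or there is a smooth
unit vector field `ξ` on `Mb`, tangent to `M` and orthogonal to `Δ`, with `φ² = ε (I - η ⊗ ξ)`,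
where `η = g(ξ, ·)`. -/
def StructureCondition (ε : ℝ)
    (φ : ∀ p : Mb, TangentSpace 𝓘(ℝ, E) p →L[ℝ] TangentSpace 𝓘(ℝ, E) p) (ι : M → Mb)
    (Δ : ∀ x : M, Submodule ℝ (TangentSpace 𝓘(ℝ, F) x)) : Prop :=
  (∀ p v, φ p (φ p v) = ε • v) ∨
  ∃ ξ : ∀ p : Mb, TangentSpace 𝓘(ℝ, E) p, SmoothField ξ ∧ (∀ p, ⟪ξ p, ξ p⟫_ℝ = 1) ∧
    (∀ p v, φ p (φ p v) = ε • (v - ⟪ξ p, v⟫_ℝ • ξ p)) ∧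
    (∀ x, ∃ v, push (F := F) E ι x v = ξ (ι x)) ∧
    ∀ x, ∀ v ∈ Δ x, ⟪push E ι x v, ξ (ι x)⟫_ℝ = 0

end Slant

end KSlant

end

set_option linter.unusedSectionVars false

noncomputable section

/-! Since `D` is orthogonal to `ξ` in the second case, both structures give `φ² = ε` on `D`, so `φ`
is isometric there. On a component `Dᵢ` the slant condition says `‖f v‖ = cos θᵢ ‖v‖`. Polarization
together with `⟪f v, w⟫ = ε ⟪v, f w⟫` turns this into `f² = ε cos² θᵢ` on `Dᵢ`
(`projComp_sq_of_slant`). Thus `λᵢ = ε cos² θᵢ`. On `(0, π/2]` the angle and the eigenvalue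
determine each other, and the value `ε`, which is that of `f²` on `D₀`, is not attained.

Each `λᵢ` is smooth, being `⟪Y, f² Y⟫ / ⟪Y, Y⟫` for a section `Y` of `Dᵢ` that does not vanish at
the point in question. The Leibniz rule gives `(∇_X f²) Y = X(λᵢ) Y + λᵢ ∇_X Y - f² ∇_X Y`
(`nablaSq_eq_of_mem`). If the left side vanishes, pair with `Y`: as `f²` is self-adjoint on `D` and
`∇_X Y ∈ D`, the last two terms cancel and `X(λᵢ) = 0`. So `λᵢ` is locally constant, and what
remains of the formula is condition (i). Conversely, if all `λᵢ` are locally constant and (i) holds,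
split `Y` into its components in the `Dᵢ` and apply the formula to each.

Condition (ii) is equivalent to the constancy of the `λᵢ` on a connected component. If they are
constant, so are the angles, and merging the `Dᵢ` with equal angle gives a slant decomposition
(`IsKPointwiseSlant.exists_isKSlantOn`). If some slant decomposition exists, possibly unrelated to
the given one, the set of eigenvalues of `f²` on `D` other than `ε` can be read off either
decomposition (`IsDecompositionOn.eigenvalues_eq_range`). Hence each continuous `λᵢ` takes values in
a fixed finite set and is constant, and `k'` counts the distinct values. On a connected `M` constant
`θᵢ` that are distinct as functions differ everywhere, so `k' = k`. -/

namespace KSlant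

/-! ### Linear algebra of the projected endomorphism in one tangent space -/

section LinearAlgebra

variable {T : Type*} [NormedAddCommGroup T] [InnerProductSpace ℝ T] [FiniteDimensional ℝ T]

/-- The linear map `v ↦ P_Δ (A v)`, where `P_Δ` is the orthogonal projection onto `Δ`. -/
def projComp (A : T →L[ℝ] T) (Δ : Submodule ℝ T) : T →L[ℝ] T :=
  Δ.starProjection ∘L A

theorem projComp_mem (A : T →L[ℝ] T) (Δ : Submodule ℝ T) (v : T) : projComp A Δ v ∈ Δ :=
  Submodule.starProjection_apply_mem _ _

theorem inner_projComp_left (A : T →L[ℝ] T) {Δ : Submodule ℝ T} (v : T) {w : T} (hw : w ∈ Δ) :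
    ⟪projComp A Δ v, w⟫_ℝ = ⟪A v, w⟫_ℝ := by
  have h := Submodule.starProjection_inner_eq_zero (K := Δ) (A v) w hw
  rw [inner_sub_left] at h
  simp only [projComp, ContinuousLinearMap.comp_apply]
  linarith

variable {A : T →L[ℝ] T} {ε : ℝ} {Δ : Submodule ℝ T}

theorem projComp_adjoint (hA : ∀ v w, ⟪A v, w⟫_ℝ = ε * ⟪v, A w⟫_ℝ) {v w : T} (hv : v ∈ Δ)
    (hw : w ∈ Δ) : ⟪projComp A Δ v, w⟫_ℝ = ε * ⟪v, projComp A Δ w⟫_ℝ := by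
  rw [inner_projComp_left A v hw, hA, real_inner_comm, ← inner_projComp_left A w hv,
    real_inner_comm]

/-- Moving `f` across the inner product twice costs the factor `ε² = 1`. -/
theorem projComp_sq_symm (hA : ∀ v w, ⟪A v, w⟫_ℝ = ε * ⟪v, A w⟫_ℝ) (hε : ε * ε = 1) {v w : T}
    (hv : v ∈ Δ) (hw : w ∈ Δ) :
    ⟪projComp A Δ (projComp A Δ v), w⟫_ℝ = ⟪v, projComp A Δ (projComp A Δ w)⟫_ℝ := by
  rw [projComp_adjoint hA (projComp_mem A Δ v) hw, projComp_adjoint hA hv (projComp_mem A Δ w),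
    ← mul_assoc, hε, one_mul]

theorem norm_apply_eq (hA : ∀ v w, ⟪A v, w⟫_ℝ = ε * ⟪v, A w⟫_ℝ) (hε : ε * ε = 1)
    {v : T} (hv : A (A v) = ε • v) : ‖A v‖ = ‖v‖ := by
  have h : ‖A v‖ ^ 2 = ‖v‖ ^ 2 := by
    rw [← real_inner_self_eq_norm_sq, ← real_inner_self_eq_norm_sq, hA, hv, inner_smul_right,
      ← mul_assoc, hε, one_mul]
  exact (sq_eq_sq₀ (norm_nonneg _) (norm_nonneg _)).1 h

/-- The residual `u - P u` is orthogonal to `P u`, so `⟪u, P u⟫ = ‖P u‖²`. If `P u = 0` the identity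
survives because the angle with the zero vector is `π/2`. -/
theorem cos_angleSubspace_mul_norm (u : T) (W : Submodule ℝ T) :
    Real.cos (angleSubspace u W) * ‖u‖ = ‖W.starProjection u‖ := by
  have h := InnerProductGeometry.cos_angle_mul_norm_mul_norm u (W.starProjection u)
  have h2 := Submodule.starProjection_inner_eq_zero (K := W) u (W.starProjection u)
    (Submodule.starProjection_apply_mem _ _)
  rw [inner_sub_left, sub_eq_zero, real_inner_self_eq_norm_sq] at h2
  rw [h2] at h
  rcases eq_or_ne (W.starProjection u) 0 with h0 | h0
  · simp [angleSubspace, h0]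
  · have h3 : ‖W.starProjection u‖ ≠ 0 := norm_ne_zero_iff.2 h0
    apply mul_right_cancel₀ h3
    unfold angleSubspace
    linarith

/-- The slant angle is measured against `W` while `f` projects onto the larger `Δ`; stability of `W`
under `f` reconciles the two projections. -/
theorem starProjection_eq_projComp {W : Submodule ℝ T} (hWΔ : W ≤ Δ) {v : T}
    (hv : projComp A Δ v ∈ W) : W.starProjection (A v) = projComp A Δ v := by
  refine Submodule.eq_starProjection_of_mem_of_inner_eq_zero hv fun w hw => ?_
  rw [inner_sub_left, inner_projComp_left A v (hWΔ hw), sub_self]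

theorem projComp_sq_of_slant (hA : ∀ v w, ⟪A v, w⟫_ℝ = ε * ⟪v, A w⟫_ℝ) (hε : ε * ε = 1)
    (hsq : ∀ v ∈ Δ, A (A v) = ε • v) {W : Submodule ℝ T} (hWΔ : W ≤ Δ)
    (hW : ∀ v ∈ W, projComp A Δ v ∈ W) {θ : ℝ}
    (hθ : ∀ v ∈ W, v ≠ 0 → angleSubspace (A v) W = θ) {v : T} (hv : v ∈ W) :
    projComp A Δ (projComp A Δ v) = (ε * Real.cos θ ^ 2) • v := by
  have hn : ∀ w ∈ W, ⟪projComp A Δ w, projComp A Δ w⟫_ℝ = Real.cos θ ^ 2 * ⟪w, w⟫_ℝ := by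
    intro w hw
    rcases eq_or_ne w 0 with rfl | h0
    · simp
    · rw [real_inner_self_eq_norm_sq, real_inner_self_eq_norm_sq,
        ← starProjection_eq_projComp hWΔ (hW w hw), ← cos_angleSubspace_mul_norm, hθ w hw h0,
        norm_apply_eq hA hε (hsq w (hWΔ hw)), mul_pow]
  -- Polarization of `hn`, possible because one `θ` serves all vectors of `W`.
  have hp : ∀ w ∈ W, ⟪projComp A Δ v, projComp A Δ w⟫_ℝ = Real.cos θ ^ 2 * ⟪v, w⟫_ℝ := by
    intro w hw
    have h1 := hn (v + w) (W.add_mem hv hw)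
    rw [map_add, real_inner_add_add_self, real_inner_add_add_self, hn v hv, hn w hw] at h1
    linarith
  have hz : ∀ w ∈ W, ⟪projComp A Δ (projComp A Δ v) - (ε * Real.cos θ ^ 2) • v, w⟫_ℝ = 0 := by
    intro w hw
    rw [inner_sub_left, projComp_adjoint hA (projComp_mem A Δ v) (hWΔ hw), hp w hw,
      inner_smul_left]
    simp; ring
  exact sub_eq_zero.1 (inner_self_eq_zero.1
    (hz _ (W.sub_mem (hW _ (hW v hv)) (W.smul_mem _ hv))))

/-- Converse of `projComp_sq_of_slant`: the eigenvalue gives `‖f v‖ = cos θ ‖v‖`, and the cosine is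
injective on `[0, π]`. It recovers the slant angle after components have been merged. -/
theorem slant_of_projComp_sq (hA : ∀ v w, ⟪A v, w⟫_ℝ = ε * ⟪v, A w⟫_ℝ) (hε : ε * ε = 1)
    (hsq : ∀ v ∈ Δ, A (A v) = ε • v) {W : Submodule ℝ T} (hWΔ : W ≤ Δ)
    (hW : ∀ v ∈ W, projComp A Δ v ∈ W) {θ : ℝ} (hθ : θ ∈ Set.Ioc 0 (Real.pi / 2))
    (h : ∀ v ∈ W, projComp A Δ (projComp A Δ v) = (ε * Real.cos θ ^ 2) • v) {v : T} (hv : v ∈ W)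
    (hv0 : v ≠ 0) : A v ≠ 0 ∧ angleSubspace (A v) W = θ := by
  have hnA := norm_apply_eq hA hε (hsq v (hWΔ hv))
  have hnv : 0 < ‖v‖ := norm_pos_iff.2 hv0
  have hc : 0 ≤ Real.cos θ :=
    Real.cos_nonneg_of_neg_pi_div_two_le_of_le (by linarith [hθ.1, Real.pi_pos]) hθ.2
  have hf : ‖projComp A Δ v‖ = Real.cos θ * ‖v‖ := by
    refine (sq_eq_sq₀ (norm_nonneg _) (by positivity)).1 ?_
    rw [← real_inner_self_eq_norm_sq, projComp_adjoint hA (hWΔ hv) (projComp_mem A Δ v), h v hv,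
      inner_smul_right, real_inner_self_eq_norm_sq, ← mul_assoc, ← mul_assoc, hε]
    ring
  refine ⟨fun h0 => ?_, ?_⟩
  · rw [h0, norm_zero] at hnA
    exact hnv.ne hnA
  · have h1 := cos_angleSubspace_mul_norm (A v) W
    rw [starProjection_eq_projComp hWΔ (hW v hv), hf, hnA] at h1
    exact Real.injOn_cos ⟨InnerProductGeometry.angle_nonneg _ _, InnerProductGeometry.angle_le_pi _ _⟩
      ⟨hθ.1.le, by linarith [hθ.2, Real.pi_pos]⟩ (mul_right_cancel₀ hnv.ne' h1)

theorem projComp_sq_of_invariant (hsq : ∀ v ∈ Δ, A (A v) = ε • v) {W : Submodule ℝ T}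
    (hWΔ : W ≤ Δ) (hW : ∀ v ∈ W, A v ∈ W) {v : T} (hv : v ∈ W) :
    projComp A Δ (projComp A Δ v) = ε • v := by
  have h : ∀ w ∈ W, projComp A Δ w = A w := fun w hw =>
    Submodule.starProjection_eq_self_iff.2 (hWΔ (hW w hw))
  rw [h v hv, h _ (hW v hv), hsq v (hWΔ hv)]

theorem cos_sq_lt_one {θ : ℝ} (hθ : θ ∈ Set.Ioc 0 (Real.pi / 2)) : Real.cos θ ^ 2 < 1 := by
  have h : 0 < Real.sin θ := Real.sin_pos_of_pos_of_lt_pi hθ.1 (by linarith [hθ.2, Real.pi_pos])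
  nlinarith [Real.sin_sq_add_cos_sq θ]

theorem mul_cos_sq_injOn (hε : ε * ε = 1) :
    Set.InjOn (fun θ : ℝ => ε * Real.cos θ ^ 2) (Set.Ioc 0 (Real.pi / 2)) := by
  intro a ha b hb h
  have h0 : ε ≠ 0 := fun h => by simp [h] at hε
  have hc : ∀ θ ∈ Set.Ioc 0 (Real.pi / 2), 0 ≤ Real.cos θ := fun θ hθ =>
    Real.cos_nonneg_of_neg_pi_div_two_le_of_le (by linarith [hθ.1, Real.pi_pos]) hθ.2
  exact Real.injOn_cos ⟨ha.1.le, by linarith [ha.2, Real.pi_pos]⟩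
    ⟨hb.1.le, by linarith [hb.2, Real.pi_pos]⟩
    ((sq_eq_sq₀ (hc a ha) (hc b hb)).1 (mul_left_cancel₀ h0 h))

theorem mul_cos_sq_ne (hε : ε * ε = 1) {θ : ℝ} (hθ : θ ∈ Set.Ioc 0 (Real.pi / 2)) :
    ε * Real.cos θ ^ 2 ≠ ε := by
  intro h
  have h0 : ε ≠ 0 := fun h => by simp [h] at hε
  have := mul_left_cancel₀ h0 (h.trans (mul_one ε).symm)
  exact (cos_sq_lt_one hθ).ne this

/-- A vector in the sum of pairwise orthogonal subspaces is the sum of its projections. -/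
theorem sum_starProjection_of_mem_iSup {J : Type*} [Fintype J] {W : J → Submodule ℝ T}
    (hW : ∀ i j, i ≠ j → ∀ v ∈ W i, ∀ w ∈ W j, ⟪v, w⟫_ℝ = 0) {v : T} (hv : v ∈ ⨆ j, W j) :
    ∑ j, (W j).starProjection v = v := by
  classical
  induction hv using Submodule.iSup_induction' with
  | mem i x hx =>
    rw [Finset.sum_eq_single i]
    · exact Submodule.starProjection_eq_self_iff.2 hx
    · intro j _ hj
      rw [Submodule.starProjection_apply_eq_zero_iff, Submodule.mem_orthogonal]
      exact fun u hu => hW j i hj u hu x hx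
    · simp
  | zero => simp
  | add x y _ _ hx hy => simp only [map_add, Finset.sum_add_distrib, hx, hy]

/-- Comparing `B v` with `b • v` gives `∑ (c j - b) P_j v = 0`. Orthogonality kills every term
separately, so `v = 0` if `b` is none of the `c j`. -/
theorem exists_eq_of_eigenvector {J : Type*} [Fintype J] {W : J → Submodule ℝ T}
    (hW : ∀ i j, i ≠ j → ∀ v ∈ W i, ∀ w ∈ W j, ⟪v, w⟫_ℝ = 0) (B : T →L[ℝ] T) (c : J → ℝ)
    (hB : ∀ j, ∀ v ∈ W j, B v = c j • v) {v : T} (hv : v ∈ ⨆ j, W j) (hv0 : v ≠ 0) {b : ℝ}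
    (hb : B v = b • v) : ∃ j, b = c j := by
  by_contra! h
  have hs := sum_starProjection_of_mem_iSup hW hv
  have h1 : ∑ j, (c j - b) • (W j).starProjection v = 0 := by
    have h2 : B v = ∑ j, c j • (W j).starProjection v := by
      conv_lhs => rw [← hs, map_sum]
      exact Finset.sum_congr rfl fun j _ => hB j _ (Submodule.starProjection_apply_mem _ _)
    simp only [sub_smul, Finset.sum_sub_distrib, ← Finset.smul_sum, hs, ← h2, hb, sub_self]
  refine hv0 ?_
  rw [← hs]
  refine Finset.sum_eq_zero fun j _ => ?_
  have h3 := congrArg (fun u => ⟪(W j).starProjection v, u⟫_ℝ) h1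
  simp only [inner_sum, inner_smul_right, inner_zero_right] at h3
  rw [Finset.sum_eq_single j] at h3
  · exact inner_self_eq_zero.1 ((mul_eq_zero.1 h3).resolve_left (sub_ne_zero.2 (h j).symm))
  · intro i _ hi
    rw [hW j i hi.symm _ (Submodule.starProjection_apply_mem _ _) _
      (Submodule.starProjection_apply_mem _ _), mul_zero]
  · simp

end LinearAlgebra

/-! ### Smooth vector fields along a map -/

section Along

open Filter Topology

variable {E : Type*} [NormedAddCommGroup E] [NormedSpace ℝ E]
  {Mb : Type*} [TopologicalSpace Mb] [ChartedSpace E Mb] [IsManifold 𝓘(ℝ, E) ∞ Mb]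
  {F : Type*} [NormedAddCommGroup F] [NormedSpace ℝ F]
  {M : Type*} [TopologicalSpace M] [ChartedSpace F M]

/-- `V` is smooth at `x` as a vector field along `ι`. -/
def SmoothAlongAt (F : Type*) [NormedAddCommGroup F] [NormedSpace ℝ F] {M : Type*}
    [TopologicalSpace M] [ChartedSpace F M] (ι : M → Mb)
    (V : ∀ x : M, TangentSpace 𝓘(ℝ, E) (ι x)) (x : M) : Prop :=
  ContMDiffAt 𝓘(ℝ, F) (𝓘(ℝ, E)).tangent ∞
    (fun y => (⟨ι y, V y⟩ : TangentBundle 𝓘(ℝ, E) Mb)) x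

theorem coords_apply_of_mem {p q : Mb}
    (hq : q ∈ (trivializationAt E (TangentSpace 𝓘(ℝ, E)) p).baseSet) (v : TangentSpace 𝓘(ℝ, E) q) :
    coords p q v = (trivializationAt E (TangentSpace 𝓘(ℝ, E)) p ⟨q, v⟩).2 :=
  Trivialization.continuousLinearMapAt_apply_of_mem ℝ _ hq v

theorem coordField_coords_self (p : Mb) (v : TangentSpace 𝓘(ℝ, E) p) :
    coordField (E := E) p (coords p p v) p = v :=
  Trivialization.symmL_continuousLinearMapAt _ (FiberBundle.mem_baseSet_trivializationAt' p) v

/-- `coords` agrees with the trivialization only over its base set, which by continuity of `ι`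
contains the images of all points near `x`. -/
theorem smoothAlongAt_iff {ι : M → Mb} {V : ∀ x : M, TangentSpace 𝓘(ℝ, E) (ι x)} {x : M} :
    SmoothAlongAt F ι V x ↔ ContMDiffAt 𝓘(ℝ, F) 𝓘(ℝ, E) ∞ ι x ∧
      ContMDiffAt 𝓘(ℝ, F) 𝓘(ℝ, E) ∞ (fun y => coords (ι x) (ι y) (V y)) x := by
  unfold SmoothAlongAt ModelWithCorners.tangent
  rw [contMDiffAt_totalSpace]
  refine and_congr_right fun h => Filter.EventuallyEq.contMDiffAt_iff ?_
  have hb := h.continuousAt.preimage_mem_nhds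
    ((trivializationAt E (TangentSpace 𝓘(ℝ, E)) (ι x)).open_baseSet.mem_nhds
      (FiberBundle.mem_baseSet_trivializationAt' (ι x)))
  filter_upwards [hb] with y hy
  exact (coords_apply_of_mem hy _).symm

theorem SmoothAlongAt.congr {ι : M → Mb} {V W : ∀ x : M, TangentSpace 𝓘(ℝ, E) (ι x)} {x : M}
    (hV : SmoothAlongAt F ι V x) (h : ∀ᶠ y in 𝓝 x, W y = V y) : SmoothAlongAt F ι W x :=
  ContMDiffAt.congr_of_eventuallyEq hV (h.mono fun y hy => by simp only [hy])

theorem SmoothAlongAt.smul {ι : M → Mb} {V : ∀ x : M, TangentSpace 𝓘(ℝ, E) (ι x)} {x : M}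
    {c : M → ℝ} (hc : ContMDiffAt 𝓘(ℝ, F) 𝓘(ℝ, ℝ) ∞ c x) (hV : SmoothAlongAt F ι V x) :
    SmoothAlongAt F ι (fun y => c y • V y) x := by
  rw [smoothAlongAt_iff] at hV ⊢
  refine ⟨hV.1, ?_⟩
  simp only [map_smul]
  exact hc.smul hV.2

theorem SmoothAlongAt.sum {ι : M → Mb} {J : Type*} {s : Finset J}
    {V : J → ∀ x : M, TangentSpace 𝓘(ℝ, E) (ι x)} {x : M} (hι : ContMDiffAt 𝓘(ℝ, F) 𝓘(ℝ, E) ∞ ι x)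
    (hV : ∀ j ∈ s, SmoothAlongAt F ι (V j) x) : SmoothAlongAt F ι (fun y => ∑ j ∈ s, V j y) x := by
  rw [smoothAlongAt_iff]
  refine ⟨hι, ?_⟩
  simp only [map_sum]
  exact contMDiffAt_finsetSum fun j hj => (smoothAlongAt_iff.1 (hV j hj)).2

theorem SmoothAlongAt.clm_apply {ι : M → Mb} {V : ∀ x : M, TangentSpace 𝓘(ℝ, E) (ι x)} {x : M}
    {φ : ∀ p : Mb, TangentSpace 𝓘(ℝ, E) p →L[ℝ] TangentSpace 𝓘(ℝ, E) p}
    (hφ : ContMDiff 𝓘(ℝ, E) (𝓘(ℝ, E).prod 𝓘(ℝ, E →L[ℝ] E)) ∞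
      (fun p => TotalSpace.mk' (E →L[ℝ] E)
        (E := fun p : Mb => TangentSpace 𝓘(ℝ, E) p →L[ℝ] TangentSpace 𝓘(ℝ, E) p) p (φ p)))
    (hV : SmoothAlongAt F ι V x) : SmoothAlongAt F ι (fun y => φ (ι y) (V y)) x := by
  have hι := (smoothAlongAt_iff.1 hV).1
  exact ContMDiffAt.clm_bundle_apply (hφ.contMDiffAt.comp x hι) hV

theorem smoothAlongAt_push [IsManifold 𝓘(ℝ, F) ∞ M] {ι : M → Mb}
    (hι : ContMDiff 𝓘(ℝ, F) 𝓘(ℝ, E) ∞ ι) {X : ∀ x : M, TangentSpace 𝓘(ℝ, F) x} {x : M}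
    (hX : ContMDiffAt 𝓘(ℝ, F) (𝓘(ℝ, F)).tangent ∞
      (fun x => (⟨x, X x⟩ : TangentBundle 𝓘(ℝ, F) M)) x) :
    SmoothAlongAt F ι (fun y => push E ι y (X y)) x := by
  have h := hι.contMDiff_tangentMap (m := ∞) (by simp)
  exact (h.contMDiffAt (x := ⟨x, X x⟩)).comp x hX

/-! ### Orthogonal projection in a smooth frame -/

section Metric

variable [RiemannianBundle (fun p : Mb => TangentSpace 𝓘(ℝ, E) p)]
    [IsContMDiffRiemannianBundle 𝓘(ℝ, E) ∞ E (fun p : Mb => TangentSpace 𝓘(ℝ, E) p)]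

theorem SmoothAlongAt.inner {ι : M → Mb} {V W : ∀ x : M, TangentSpace 𝓘(ℝ, E) (ι x)} {x : M}
    (hV : SmoothAlongAt F ι V x) (hW : SmoothAlongAt F ι W x) :
    ContMDiffAt 𝓘(ℝ, F) 𝓘(ℝ, ℝ) ∞ (fun y => ⟪V y, W y⟫_ℝ) x :=
  ContMDiffAt.inner_bundle hV hW

theorem contMDiffAt_det {n : Type*} [Fintype n] [DecidableEq n] {G : M → Matrix n n ℝ} {x : M}
    (hG : ∀ i j, ContMDiffAt 𝓘(ℝ, F) 𝓘(ℝ, ℝ) ∞ (fun y => G y i j) x) :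
    ContMDiffAt 𝓘(ℝ, F) 𝓘(ℝ, ℝ) ∞ (fun y => (G y).det) x := by
  simp only [Matrix.det_apply']
  exact contMDiffAt_finsetSum fun σ _ =>
    contMDiffAt_const.mul (contMDiffAt_finsetProd fun i _ => hG _ _)

/-- The coefficients, in a frame `V`, of the orthogonal projection of `Z` onto the span. -/
def frameCoeff {ι : M → Mb} {r : ℕ} (V : Fin r → ∀ x : M, TangentSpace 𝓘(ℝ, E) (ι x))
    (Z : ∀ x : M, TangentSpace 𝓘(ℝ, E) (ι x)) (j : Fin r) (y : M) : ℝ :=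
  (Matrix.gram ℝ fun i => V i y).det⁻¹ *
    ((Matrix.gram ℝ fun i => V i y).updateCol j fun i => ⟪V i y, Z y⟫_ℝ).det

theorem contMDiffAt_frameCoeff {ι : M → Mb} {r : ℕ}
    {V : Fin r → ∀ x : M, TangentSpace 𝓘(ℝ, E) (ι x)}
    {Z : ∀ x : M, TangentSpace 𝓘(ℝ, E) (ι x)} {x : M} (hV : ∀ j, SmoothAlongAt F ι (V j) x)
    (hZ : SmoothAlongAt F ι Z x) (hli : LinearIndependent ℝ fun j => V j x) (j : Fin r) :
    ContMDiffAt 𝓘(ℝ, F) 𝓘(ℝ, ℝ) ∞ (frameCoeff V Z j) x := by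
  have hG : ∀ i j, ContMDiffAt 𝓘(ℝ, F) 𝓘(ℝ, ℝ) ∞
      (fun y => Matrix.gram ℝ (fun i => V i y) i j) x := fun i j => (hV i).inner (hV j)
  refine ContMDiffAt.mul ((contMDiffAt_det hG).inv₀ ?_) (contMDiffAt_det fun i l => ?_)
  · exact Matrix.det_gram_ne_zero_iff_linearIndependent.2 hli
  · simp only [Matrix.updateCol_apply]
    split_ifs
    · exact (hV i).inner hZ
    · exact hG i l

/-- The coefficients solve the normal equations, whose matrix is the Gram matrix. Cramer's rule
expresses them through determinants, which makes their smoothness visible. -/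
theorem starProjection_span_frame [FiniteDimensional ℝ E] {ι : M → Mb} {r : ℕ}
    (V : Fin r → ∀ x : M, TangentSpace 𝓘(ℝ, E) (ι x))
    (Z : ∀ x : M, TangentSpace 𝓘(ℝ, E) (ι x)) {y : M}
    (hli : LinearIndependent ℝ fun j => V j y) :
    (Submodule.span ℝ (Set.range fun j => V j y)).starProjection (Z y) =
      ∑ j, frameCoeff V Z j y • V j y := by
  refine Submodule.eq_starProjection_of_mem_of_inner_eq_zero
    (Submodule.sum_mem _ fun j _ => Submodule.smul_mem _ _ (Submodule.subset_span ⟨j, rfl⟩)) ?_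
  have hd := Matrix.det_gram_ne_zero_iff_linearIndependent.2 hli
  have hc := Matrix.mulVec_cramer (Matrix.gram ℝ fun i => V i y) (fun i => ⟪V i y, Z y⟫_ℝ)
  have key : ∀ i, ⟪Z y - ∑ j, frameCoeff V Z j y • V j y, V i y⟫_ℝ = 0 := by
    intro i
    have h := congrFun hc i
    simp only [Matrix.mulVec, dotProduct, Matrix.cramer_apply, Matrix.gram_apply, Pi.smul_apply,
      smul_eq_mul] at h
    rw [inner_sub_left, sum_inner, real_inner_comm, sub_eq_zero]
    simp only [frameCoeff, inner_smul_left]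
    rw [← mul_right_inj' hd, ← h, Finset.mul_sum]
    refine Finset.sum_congr rfl fun j _ => ?_
    rw [real_inner_comm (V i y) (V j y)]
    simp only [conj_trivial]
    field_simp
  intro w hw
  induction hw using Submodule.span_induction with
  | mem w hw => obtain ⟨i, rfl⟩ := hw; exact key i
  | zero => simp
  | add a b _ _ ha hb => rw [inner_add_right, ha, hb, add_zero]
  | smul a b _ hb => rw [inner_smul_right, hb, mul_zero]

/-! ### Additivity and Leibniz rule for the covariant derivative -/

section CovDeriv

variable [FiniteDimensional ℝ E]

theorem mdifferentiableAt_metricCoeff (p : Mb) (u v : E) :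
    MDifferentiableAt 𝓘(ℝ, E) 𝓘(ℝ, ℝ) (metricCoeff p u v) p := by
  have h : ∀ u : E, SmoothAlongAt E (fun q : Mb => q) (coordField p u) p := by
    intro u
    rw [smoothAlongAt_iff]
    refine ⟨contMDiffAt_id, (contMDiffAt_const (c := u)).congr_of_eventuallyEq ?_⟩
    have hb := (trivializationAt E (TangentSpace 𝓘(ℝ, E)) p).open_baseSet.mem_nhds
      (FiberBundle.mem_baseSet_trivializationAt' p)
    filter_upwards [hb] with q hq
    exact Trivialization.continuousLinearMapAt_symmL _ hq u
  exact ((h u).inner (h v)).mdifferentiableAt (by simp)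

theorem metricCoeff_comm (p : Mb) (u v : E) : metricCoeff p u v = metricCoeff p v u :=
  funext fun _ => real_inner_comm _ _

theorem metricCoeffDeriv_comm (p : Mb) (w u v : E) :
    metricCoeffDeriv p w u v = metricCoeffDeriv p w v u := by
  unfold metricCoeffDeriv; rw [metricCoeff_comm]

theorem metricCoeffDeriv_add_smul_right (p : Mb) (w u v v' : E) (c : ℝ) :
    metricCoeffDeriv p w u (v + c • v') =
      metricCoeffDeriv p w u v + c * metricCoeffDeriv p w u v' := by
  have h : metricCoeff p u (v + c • v') = metricCoeff p u v + c • metricCoeff p u v' := by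
    funext q
    simp only [metricCoeff, coordField, map_add, map_smul, inner_add_right, inner_smul_right,
      Pi.add_apply, Pi.smul_apply, smul_eq_mul]
  unfold metricCoeffDeriv
  rw [h, mfderiv_add (mdifferentiableAt_metricCoeff p u v)
    ((mdifferentiableAt_metricCoeff p u v').const_smul c),
    const_smul_mfderiv (mdifferentiableAt_metricCoeff p u v')]
  rfl

theorem metricCoeffDeriv_add_smul_left (p : Mb) (w w' u v : E) (c : ℝ) :
    metricCoeffDeriv p (w + c • w') u v =
      metricCoeffDeriv p w u v + c * metricCoeffDeriv p w' u v := by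
  simp only [metricCoeffDeriv, coordField, map_add, map_smul]
  rfl

theorem christoffel_add_smul (p : Mb) (u v v' : E) (c : ℝ) :
    christoffel p u (v + c • v') = christoffel p u v + c • christoffel p u v' := by
  have h : ∀ w, christoffelFirst p u (v + c • v') w =
      christoffelFirst p u v w + c * christoffelFirst p u v' w := by
    intro w
    simp only [christoffelFirst, metricCoeffDeriv_comm p u _ w,
      metricCoeffDeriv_add_smul_right, metricCoeffDeriv_add_smul_left]
    ring
  simp only [christoffel, h, add_smul, Finset.sum_add_distrib, mul_smul, Finset.smul_sum]

/-- The Christoffel symbol `Γ(u, ·)` as a linear map. -/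
def christoffelLinear (p : Mb) (u : E) : E →ₗ[ℝ] TangentSpace 𝓘(ℝ, E) p where
  toFun := christoffel p u
  map_add' v w := by simpa using christoffel_add_smul p u v w 1
  map_smul' c v := by
    -- The scalar `-1` yields `Γ(u, 0) = Γ(u, 0) - Γ(u, 0)`.
    have h0 : christoffel (E := E) p u 0 = 0 := by simpa using christoffel_add_smul p u 0 0 (-1)
    simpa [h0] using christoffel_add_smul p u 0 v c

theorem covDerivAlong_congr {ι : M → Mb} {V W : ∀ x : M, TangentSpace 𝓘(ℝ, E) (ι x)} {x : M}
    (h : ∀ᶠ y in 𝓝 x, W y = V y) (a : TangentSpace 𝓘(ℝ, F) x) :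
    covDerivAlong ι W x a = covDerivAlong ι V x a := by
  have h1 : (fun y => coords (ι x) (ι y) (W y)) =ᶠ[𝓝 x] fun y => coords (ι x) (ι y) (V y) :=
    h.mono fun y hy => by simp only [hy]
  unfold covDerivAlong
  rw [h1.mfderiv_eq, h.self_of_nhds]

/-- `G` is the derivative of the components of `V` in the chart centred at `ι x`. -/
def HasCoordDerivAt (ι : M → Mb) (V : ∀ x : M, TangentSpace 𝓘(ℝ, E) (ι x)) (x : M)
    (G : F →L[ℝ] E) : Prop :=
  HasMFDerivAt 𝓘(ℝ, F) 𝓘(ℝ, E) (fun y => coords (ι x) (ι y) (V y)) x G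

theorem covDerivAlong_eq {ι : M → Mb} {V : ∀ x : M, TangentSpace 𝓘(ℝ, E) (ι x)} {x : M}
    {G : F →L[ℝ] E} (hG : HasCoordDerivAt ι V x G) (a : TangentSpace 𝓘(ℝ, F) x) :
    covDerivAlong ι V x a = (trivializationAt E (TangentSpace 𝓘(ℝ, E)) (ι x)).symmL ℝ (ι x) (G a) +
      christoffelLinear (ι x) (coords (ι x) (ι x) (mfderiv 𝓘(ℝ, F) 𝓘(ℝ, E) ι x a))
        (coords (ι x) (ι x) (V x)) := by
  unfold covDerivAlong
  rw [HasMFDerivAt.mfderiv hG]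
  rfl

theorem SmoothAlongAt.hasCoordDerivAt {ι : M → Mb} {V : ∀ x : M, TangentSpace 𝓘(ℝ, E) (ι x)}
    {x : M} (hV : SmoothAlongAt F ι V x) : ∃ G : F →L[ℝ] E, HasCoordDerivAt ι V x G :=
  ⟨_, ((smoothAlongAt_iff.1 hV).2.mdifferentiableAt (by simp)).hasMFDerivAt⟩

theorem HasCoordDerivAt.sum {ι : M → Mb} {J : Type} [Fintype J]
    {V : J → ∀ x : M, TangentSpace 𝓘(ℝ, E) (ι x)} {x : M} {G : J → F →L[ℝ] E}
    (hG : ∀ j, HasCoordDerivAt ι (V j) x (G j)) :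
    HasCoordDerivAt ι (fun y => ∑ j, V j y) x (∑ j, G j) := by
  have h := HasMFDerivAt.sum (t := Finset.univ) (z := x)
    (f := fun j y => coords (ι x) (ι y) (V j y)) (f' := G) fun j _ => hG j
  refine HasMFDerivAt.congr_of_eventuallyEq h (Eventually.of_forall fun y => ?_)
  rw [Finset.sum_apply]
  exact map_sum _ _ _

theorem HasCoordDerivAt.smul {ι : M → Mb} {c : M → ℝ} {V : ∀ x : M, TangentSpace 𝓘(ℝ, E) (ι x)}
    {x : M} {C : F →L[ℝ] ℝ} (hc : HasMFDerivAt 𝓘(ℝ, F) 𝓘(ℝ, ℝ) c x C) {G : F →L[ℝ] E}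
    (hG : HasCoordDerivAt ι V x G) :
    HasCoordDerivAt ι (fun y => c y • V y) x
      (c x • G + C.smulRight (coords (ι x) (ι x) (V x))) := by
  have h : HasMFDerivAt 𝓘(ℝ, F) 𝓘(ℝ, E) (fun y => c y • coords (ι x) (ι y) (V y)) x
      (c x • G + C.smulRight (coords (ι x) (ι x) (V x))) := by
    refine ⟨hc.1.smul hG.1, ?_⟩
    have h2 := HasFDerivWithinAt.smul hc.2 hG.2
    have h3 : writtenInExtChartAt 𝓘(ℝ, F) 𝓘(ℝ, ℝ) x c (extChartAt 𝓘(ℝ, F) x x) = c x :=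
      congrArg c (extChartAt_to_inv x)
    have h4 : writtenInExtChartAt 𝓘(ℝ, F) 𝓘(ℝ, E) x (fun y => coords (ι x) (ι y) (V y))
        (extChartAt 𝓘(ℝ, F) x x) = coords (ι x) (ι x) (V x) :=
      congrArg (fun y => coords (ι x) (ι y) (V y)) (extChartAt_to_inv (I := 𝓘(ℝ, F)) x)
    rw [h3, h4] at h2
    exact h2
  exact HasMFDerivAt.congr_of_eventuallyEq h (Eventually.of_forall fun y => map_smul _ _ _)

theorem covDerivAlong_sum {ι : M → Mb} {J : Type} [Fintype J]
    {V : J → ∀ x : M, TangentSpace 𝓘(ℝ, E) (ι x)} {x : M}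
    (hV : ∀ j, SmoothAlongAt F ι (V j) x) (a : TangentSpace 𝓘(ℝ, F) x) :
    covDerivAlong ι (fun y => ∑ j, V j y) x a = ∑ j, covDerivAlong ι (V j) x a := by
  choose G hG using fun j => (hV j).hasCoordDerivAt
  have h : ∀ b : F, (trivializationAt E (TangentSpace 𝓘(ℝ, E)) (ι x)).symmL ℝ (ι x)
      ((∑ j, G j) b) = ∑ j, (trivializationAt E (TangentSpace 𝓘(ℝ, E)) (ι x)).symmL ℝ (ι x)
        (G j b) := by
    intro b
    rw [sum_apply, map_sum]
  rw [covDerivAlong_eq (.sum hG), map_sum, map_sum]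
  refine (congrArg (· + _) (h a)).trans ?_
  rw [← Finset.sum_add_distrib]
  exact Finset.sum_congr rfl fun j _ => (covDerivAlong_eq (hG j) a).symm

theorem covDerivAlong_smul {ι : M → Mb} {c : M → ℝ} {V : ∀ x : M, TangentSpace 𝓘(ℝ, E) (ι x)}
    {x : M} {C : F →L[ℝ] ℝ} (hc : HasMFDerivAt 𝓘(ℝ, F) 𝓘(ℝ, ℝ) c x C)
    (hV : SmoothAlongAt F ι V x) (a : TangentSpace 𝓘(ℝ, F) x) :
    covDerivAlong ι (fun y => c y • V y) x a = C a • V x + c x • covDerivAlong ι V x a := by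
  obtain ⟨G, hG⟩ := hV.hasCoordDerivAt
  have h : ∀ b : F, (trivializationAt E (TangentSpace 𝓘(ℝ, E)) (ι x)).symmL ℝ (ι x)
      ((c x • G + C.smulRight (coords (ι x) (ι x) (V x))) b) =
        c x • (trivializationAt E (TangentSpace 𝓘(ℝ, E)) (ι x)).symmL ℝ (ι x) (G b) +
          C b • V x := by
    intro b
    rw [add_apply, smul_apply, ContinuousLinearMap.smulRight_apply, map_add, map_smul, map_smul]
    exact congrArg (_ + C b • ·) (coordField_coords_self (ι x) (V x))
  rw [covDerivAlong_eq (hG.smul hc), covDerivAlong_eq hG, map_smul, map_smul]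
  refine (congrArg (· + _) (h a)).trans ?_
  rw [smul_add]
  abel

end CovDeriv

end Metric

end Along

/-! ### Global extension of local fields, and functions with zero derivative -/

section Extension

open Filter Topology

variable {F : Type*} [NormedAddCommGroup F] [NormedSpace ℝ F]
  {M : Type*} [TopologicalSpace M] [ChartedSpace F M]

theorem exists_cutoff [FiniteDimensional ℝ F] [IsManifold 𝓘(ℝ, F) ∞ M] [T2Space M] {N : Set M}
    (hN : IsOpen N) {x : M} (hx : x ∈ N)
    {X : ∀ x : M, TangentSpace 𝓘(ℝ, F) x} (hX : SmoothFieldOn N X) :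
    ∃ b : M → ℝ, b x = 1 ∧ (∀ y ∉ N, b y = 0) ∧ SmoothField fun y => b y • X y := by
  obtain ⟨f, -, hf⟩ := (SmoothBumpFunction.nhds_basis_tsupport (I := 𝓘(ℝ, F)) x).mem_iff.1
    (hN.mem_nhds hx)
  refine ⟨f, f.eq_one, fun y hy => image_eq_zero_of_notMem_tsupport fun h => hy (hf h), ?_⟩
  have := ContMDiffOn.smul_section_of_tsupport (f.contMDiff.contMDiffOn (s := N)) hN hf hX
  exact this.contMDiffOn

theorem exists_smoothField_apply_eq [FiniteDimensional ℝ F] [IsManifold 𝓘(ℝ, F) ∞ M] [T2Space M]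
    (x : M) (a : TangentSpace 𝓘(ℝ, F) x) :
    ∃ X : ∀ x : M, TangentSpace 𝓘(ℝ, F) x, SmoothField X ∧ X x = a := by
  obtain ⟨s, hs, h⟩ := FiberBundle.exists_contMDiffOn_extend (k := ∞) 𝓘(ℝ, F) F a
  obtain ⟨N, hNs, hN, hx⟩ := mem_nhds_iff.1 hs
  obtain ⟨b, hb, -, hX⟩ := exists_cutoff hN hx (X := FiberBundle.extend F a) (h.mono hNs)
  exact ⟨_, hX, by simp [hb]⟩

/-- In a chart the function has zero derivative on a ball, which is convex, so it is locally
constant. -/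
theorem eqOn_connectedComponent_of_mfderiv_eq_zero {f : M → ℝ}
    [IsManifold 𝓘(ℝ, F) ∞ M] (hf : ∀ x, MDifferentiableAt 𝓘(ℝ, F) 𝓘(ℝ, ℝ) f x)
    (hf' : ∀ x, mfderiv 𝓘(ℝ, F) 𝓘(ℝ, ℝ) f x = 0) {x y : M} (hy : y ∈ connectedComponent x) :
    f y = f x := by
  have hl : IsLocallyConstant f := by
    rw [IsLocallyConstant.iff_eventually_eq]
    intro x
    set e := chartAt F x
    have h0 : ∀ z ∈ e.target, HasFDerivAt (f ∘ e.symm) (0 : F →L[ℝ] ℝ) z := by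
      intro z hz
      have h1 : MDifferentiableAt 𝓘(ℝ, F) 𝓘(ℝ, F) e.symm z :=
        mdifferentiableAt_atlas_symm (I := 𝓘(ℝ, F)) (chart_mem_atlas F x) hz
      have h2 := (hf (e.symm z)).hasMFDerivAt.comp z h1.hasMFDerivAt
      rw [hf'] at h2
      have h3 := h2.hasFDerivAt
      convert! h3 using 1
    obtain ⟨r, hr, hb⟩ := Metric.isOpen_iff.1 e.open_target (e x) (e.map_source (mem_chart_source F x))
    have hx : e.source ∩ e ⁻¹' Metric.ball (e x) r ∈ 𝓝 x :=
      inter_mem (e.open_source.mem_nhds (mem_chart_source F x))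
        ((e.continuousAt (mem_chart_source F x)).preimage_mem_nhds (Metric.ball_mem_nhds _ hr))
    filter_upwards [hx] with y hy
    have h4 := (convex_ball (e x) r).is_const_of_fderivWithin_eq_zero (𝕜 := ℝ)
      (f := f ∘ e.symm)
      (fun z hz => (h0 z (hb hz)).differentiableAt.differentiableWithinAt)
      (fun z hz => (h0 z (hb hz)).hasFDerivWithinAt.fderivWithin
        (Metric.isOpen_ball.uniqueDiffWithinAt hz)) hy.2 (Metric.mem_ball_self hr)
    simpa [e.left_inv hy.1, e.left_inv (mem_chart_source F x)] using h4
  exact hl.apply_eq_of_isPreconnected isPreconnected_connectedComponent hy mem_connectedComponent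

end Extension

/-! ### Regular distributions and their smooth projections -/

section Distributions

open Filter Topology

variable {E : Type*} [NormedAddCommGroup E] [NormedSpace ℝ E] [FiniteDimensional ℝ E]
  {Mb : Type*} [TopologicalSpace Mb] [ChartedSpace E Mb] [IsManifold 𝓘(ℝ, E) ∞ Mb]
  [RiemannianBundle (fun p : Mb => TangentSpace 𝓘(ℝ, E) p)]
  {F : Type*} [NormedAddCommGroup F] [NormedSpace ℝ F]
  {M : Type*} [TopologicalSpace M] [ChartedSpace F M] [IsManifold 𝓘(ℝ, F) ∞ M]
  {ι : M → Mb} {φ : ∀ p : Mb, TangentSpace 𝓘(ℝ, E) p →L[ℝ] TangentSpace 𝓘(ℝ, E) p}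

theorem SmoothFieldOn.contMDiffAt {N : Set M} (hN : IsOpen N)
    {X : ∀ x : M, TangentSpace 𝓘(ℝ, F) x} (hX : SmoothFieldOn N X) {x : M} (hx : x ∈ N) :
    ContMDiffAt 𝓘(ℝ, F) (𝓘(ℝ, F)).tangent ∞ (fun x => (⟨x, X x⟩ : TangentBundle 𝓘(ℝ, F) M)) x :=
  ContMDiffOn.contMDiffAt hX (hN.mem_nhds hx)

theorem push_mem_pushSub {x : M} {W : Submodule ℝ (TangentSpace 𝓘(ℝ, F) x)}
    {v : TangentSpace 𝓘(ℝ, F) x} (hv : v ∈ W) : push E ι x v ∈ pushSub E ι x W :=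
  Submodule.mem_map_of_mem hv

theorem pushSub_mono {x : M} {W W' : Submodule ℝ (TangentSpace 𝓘(ℝ, F) x)} (h : W ≤ W') :
    pushSub E ι x W ≤ pushSub E ι x W' :=
  Submodule.map_mono h

theorem pushSub_total {k : ℕ} (D : Fin (k + 1) → ∀ x : M, Submodule ℝ (TangentSpace 𝓘(ℝ, F) x))
    (x : M) : pushSub E ι x (total D x) = ⨆ i, pushSub E ι x (D i x) :=
  Submodule.map_iSup _ _

theorem comp_eq_projComp (Δ : ∀ x : M, Submodule ℝ (TangentSpace 𝓘(ℝ, F) x)) (x : M)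
    (v : TangentSpace 𝓘(ℝ, E) (ι x)) :
    comp φ ι Δ x v = projComp (φ (ι x)) (pushSub E ι x (Δ x)) v :=
  rfl

theorem le_total {k : ℕ} (D : Fin (k + 1) → ∀ x : M, Submodule ℝ (TangentSpace 𝓘(ℝ, F) x))
    (i : Fin (k + 1)) (x : M) : D i x ≤ total D x :=
  le_iSup (fun i => D i x) i

theorem le_proper {k : ℕ} (D : Fin (k + 1) → ∀ x : M, Submodule ℝ (TangentSpace 𝓘(ℝ, F) x))
    (i : Fin k) (x : M) : D i.succ x ≤ proper D x :=
  le_iSup (fun i : Fin k => D i.succ x) i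

theorem IsRegularDistributionOn.mono {U U' : Set M} (hU' : IsOpen U') (h : U' ⊆ U)
    {D : ∀ x : M, Submodule ℝ (TangentSpace 𝓘(ℝ, F) x)} (hD : IsRegularDistributionOn U D) :
    IsRegularDistributionOn U' D := by
  obtain ⟨r, hr⟩ := hD
  refine ⟨r, fun x hx => ?_⟩
  obtain ⟨N, hN, hxN, -, V, hV, hs⟩ := hr x (h hx)
  exact ⟨N ∩ U', hN.inter hU', ⟨hxN, hx⟩, Set.inter_subset_right, V,
    fun j => (hV j).mono Set.inter_subset_left, fun y hy => hs y hy.1⟩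

/-- The rank `r` is the same at all points, so being nonzero at one point forces `r > 0` everywhere.
-/
theorem IsRegularDistributionOn.ne_bot {U : Set M}
    {D : ∀ x : M, Submodule ℝ (TangentSpace 𝓘(ℝ, F) x)} (hD : IsRegularDistributionOn U D)
    (hn : IsNonNullOn U D) {y : M} (hy : y ∈ U) : D y ≠ ⊥ := by
  obtain ⟨r, hr⟩ := hD
  obtain ⟨x, hx, hx0⟩ := hn
  obtain ⟨N, -, hxN, -, V, -, hs⟩ := hr x hx
  obtain ⟨N', -, hyN, -, V', -, hs'⟩ := hr y hy
  intro h0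
  have hz : ∀ j, V' j y = 0 := fun j => by
    have : V' j y ∈ D y := (hs' y hyN).2 ▸ Submodule.subset_span ⟨j, rfl⟩
    rwa [h0, Submodule.mem_bot] at this
  rcases r with _ | r
  · refine hx0 ?_
    rw [← (hs x hxN).2, Set.range_eq_empty, Submodule.span_empty]
  · exact (hs' y hyN).1.ne_zero 0 (hz 0)

/-- The sum of finitely many pairwise orthogonal regular distributions is regular. -/
theorem IsRegularDistributionOn.iSup {J : Type*} [Finite J] {U : Set M} (hU : IsOpen U)
    (hι' : ∀ x, Function.Injective (mfderiv 𝓘(ℝ, F) 𝓘(ℝ, E) ι x))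
    {D : J → ∀ x : M, Submodule ℝ (TangentSpace 𝓘(ℝ, F) x)}
    (hD : ∀ j, IsRegularDistributionOn U (D j))
    (ho : ∀ i j, i ≠ j → ∀ x ∈ U, ∀ v ∈ D i x, ∀ w ∈ D j x, ⟪push E ι x v, push E ι x w⟫_ℝ = 0) :
    IsRegularDistributionOn U fun x => ⨆ j, D j x := by
  have := Fintype.ofFinite J
  choose r hr using hD
  let e := (Fintype.equivFin (Σ j, Fin (r j))).symm
  refine ⟨Fintype.card (Σ j, Fin (r j)), fun x hx => ?_⟩
  choose N hN hxN hNU V hV hs using fun j => hr j x hx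
  refine ⟨U ∩ ⋂ j, N j, hU.inter (isOpen_iInter_of_finite hN), ⟨hx, Set.mem_iInter.2 hxN⟩,
    Set.inter_subset_left, fun m => V (e m).1 (e m).2, fun m => ?_, fun y hy => ⟨?_, ?_⟩⟩
  · exact (hV _ _).mono fun y hy => Set.mem_iInter.1 hy.2 _
  · have hyN := Set.mem_iInter.1 hy.2
    refine (linearIndependent_equiv e (f := fun p : Σ j, Fin (r j) => V p.1 p.2 y)).2 ?_
    rw [Fintype.linearIndependent_iff]
    intro c hc
    set u : J → TangentSpace 𝓘(ℝ, F) y := fun j => ∑ l, c ⟨j, l⟩ • V j l y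
    have hc' : ∑ j, u j = 0 := by rw [← hc, Fintype.sum_sigma]
    have hum : ∀ j, u j ∈ D j y := fun j => by
      rw [← (hs j y (hyN j)).2]
      exact Submodule.sum_mem _ fun l _ => Submodule.smul_mem _ _ (Submodule.subset_span ⟨l, rfl⟩)
    have hu0 : ∀ j, u j = 0 := by
      intro j
      -- Pairing the vanishing sum with its own `j`-th part isolates `‖u j‖²`.
      have h1 : ⟪push E ι y (u j), push E ι y (∑ i, u i)⟫_ℝ = 0 := by
        rw [hc', map_zero, inner_zero_right]
      rw [map_sum (push E ι y) u, inner_sum, Finset.sum_eq_single j] at h1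
      · have h2 := inner_self_eq_zero.1 h1
        exact hι' y (h2.trans (map_zero (push E ι y)).symm)
      · exact fun i _ hij => ho j i hij.symm y hy.1 _ (hum j) _ (hum i)
      · simp
    rintro ⟨j, l⟩
    exact Fintype.linearIndependent_iff.1 (hs j y (hyN j)).1 (fun l => c ⟨j, l⟩) (hu0 j) l
  · have hyN := Set.mem_iInter.1 hy.2
    have h1 : (Set.range fun m => V (e m).1 (e m).2 y) = ⋃ j, Set.range fun l => V j l y := by
      rw [← Set.range_sigma_eq_iUnion_range fun p : Σ j, Fin (r j) => V p.1 p.2 y]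
      exact e.surjective.range_comp fun p : Σ j, Fin (r j) => V p.1 p.2 y
    rw [h1, Submodule.span_iUnion]
    exact iSup_congr fun j => (hs j y (hyN j)).2

variable [IsContMDiffRiemannianBundle 𝓘(ℝ, E) ∞ E (fun p : Mb => TangentSpace 𝓘(ℝ, E) p)]

/-- The projection of a smooth field along `ι` onto a regular distribution is, near each point, a
combination of the fields of a frame of the distribution with smooth coefficients. -/
theorem IsRegularDistributionOn.exists_projection_eq (hι : ContMDiff 𝓘(ℝ, F) 𝓘(ℝ, E) ∞ ι)
    (hι' : ∀ x, Function.Injective (mfderiv 𝓘(ℝ, F) 𝓘(ℝ, E) ι x))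
    {D : ∀ x : M, Submodule ℝ (TangentSpace 𝓘(ℝ, F) x)}
    (hD : IsRegularDistributionOn Set.univ D) {Z : ∀ x : M, TangentSpace 𝓘(ℝ, E) (ι x)} {x : M}
    (hZ : SmoothAlongAt F ι Z x) : ∃ X : ∀ x : M, TangentSpace 𝓘(ℝ, F) x,
      ContMDiffAt 𝓘(ℝ, F) (𝓘(ℝ, F)).tangent ∞ (fun x => (⟨x, X x⟩ : TangentBundle 𝓘(ℝ, F) M)) x ∧
      ∀ᶠ y in 𝓝 x, X y ∈ D y ∧ (pushSub E ι y (D y)).starProjection (Z y) = push E ι y (X y) := by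
  obtain ⟨r, hr⟩ := hD
  obtain ⟨N, hN, hxN, -, V, hV, hs⟩ := hr x trivial
  have hli : ∀ y ∈ N, LinearIndependent ℝ fun j => push E ι y (V j y) := fun y hy =>
    (hs y hy).1.map' (push E ι y).toLinearMap (LinearMap.ker_eq_bot.2 (hι' y))
  have hVs : ∀ j, SmoothAlongAt F ι (fun y => push E ι y (V j y)) x := fun j =>
    smoothAlongAt_push hι ((hV j).contMDiffAt hN hxN)
  refine ⟨fun y => ∑ j, frameCoeff (fun j y => push E ι y (V j y)) Z j y • V j y, ?_, ?_⟩
  · exact ContMDiffAt.sum_section fun j _ =>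
      (contMDiffAt_frameCoeff hVs hZ (hli x hxN) j).smul_section ((hV j).contMDiffAt hN hxN)
  · filter_upwards [hN.mem_nhds hxN] with y hy
    constructor
    · rw [← (hs y hy).2]
      exact Submodule.sum_mem _ fun l _ => Submodule.smul_mem _ _ (Submodule.subset_span ⟨l, rfl⟩)
    · have h1 : pushSub E ι y (D y) =
          Submodule.span ℝ (Set.range fun j => push E ι y (V j y)) := by
        rw [← (hs y hy).2, pushSub, Submodule.map_span, ← Set.range_comp]
        rfl
      rw [h1, map_sum, starProjection_span_frame (fun j y => push E ι y (V j y)) Z (hli y hy)]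
      exact Finset.sum_congr rfl fun j _ => (map_smul _ _ _).symm

theorem IsRegularDistributionOn.smoothAlongAt_projection
    (hι : ContMDiff 𝓘(ℝ, F) 𝓘(ℝ, E) ∞ ι)
    (hι' : ∀ x, Function.Injective (mfderiv 𝓘(ℝ, F) 𝓘(ℝ, E) ι x))
    {D : ∀ x : M, Submodule ℝ (TangentSpace 𝓘(ℝ, F) x)}
    (hD : IsRegularDistributionOn Set.univ D) {Z : ∀ x : M, TangentSpace 𝓘(ℝ, E) (ι x)} {x : M}
    (hZ : SmoothAlongAt F ι Z x) :
    SmoothAlongAt F ι (fun y => (pushSub E ι y (D y)).starProjection (Z y)) x := by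
  obtain ⟨X, hX, h⟩ := hD.exists_projection_eq hι hι' hZ
  exact (smoothAlongAt_push hι hX).congr (h.mono fun y hy => hy.2)

theorem IsRegularDistributionOn.exists_smoothField_projection
    (hι : ContMDiff 𝓘(ℝ, F) 𝓘(ℝ, E) ∞ ι)
    (hι' : ∀ x, Function.Injective (mfderiv 𝓘(ℝ, F) 𝓘(ℝ, E) ι x))
    {D : ∀ x : M, Submodule ℝ (TangentSpace 𝓘(ℝ, F) x)}
    (hD : IsRegularDistributionOn Set.univ D) {Z : ∀ x : M, TangentSpace 𝓘(ℝ, E) (ι x)}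
    (hZ : ∀ x, SmoothAlongAt F ι Z x) : ∃ X : ∀ x : M, TangentSpace 𝓘(ℝ, F) x,
      SmoothField X ∧
      ∀ y, X y ∈ D y ∧ (pushSub E ι y (D y)).starProjection (Z y) = push E ι y (X y) := by
  have h : ∀ y, ∃ v, v ∈ D y ∧ push E ι y v = (pushSub E ι y (D y)).starProjection (Z y) :=
    fun y => Submodule.starProjection_apply_mem (pushSub E ι y (D y)) (Z y)
  choose X hX hX' using h
  refine ⟨X, fun x _ => ContMDiffAt.contMDiffWithinAt ?_, fun y => ⟨hX y, (hX' y).symm⟩⟩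
  obtain ⟨X', hXs, h⟩ := hD.exists_projection_eq hι hι' (hZ x)
  refine ContMDiffAt.congr_of_eventuallyEq hXs (h.mono fun y hy => ?_)
  -- The field was chosen pointwise; injectivity of `dι` identifies it with the local smooth one.
  have : X y = X' y := hι' y ((hX' y).trans hy.2)
  simp only [this]

theorem contMDiffAt_of_smul_eq {V W : ∀ x : M, TangentSpace 𝓘(ℝ, E) (ι x)} {c : M → ℝ} {x : M}
    (hV : SmoothAlongAt F ι V x) (hW : SmoothAlongAt F ι W x) (h0 : V x ≠ 0)
    (h : ∀ᶠ y in 𝓝 x, W y = c y • V y) : ContMDiffAt 𝓘(ℝ, F) 𝓘(ℝ, ℝ) ∞ c x := by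
  have hn : ⟪V x, V x⟫_ℝ ≠ 0 := inner_self_ne_zero.2 h0
  refine ((hV.inner hW).mul ((hV.inner hV).inv₀ hn)).congr_of_eventuallyEq ?_
  filter_upwards [h, (hV.inner hV).continuousAt.eventually_ne hn] with y hy hy0
  rw [Pi.mul_apply, hy, inner_smul_right, mul_inv_cancel_right₀ hy0]

end Distributions

/-! ### Eigenvalues of `f²` and slant decompositions -/

section Slant

open Filter Topology

variable {E : Type*} [NormedAddCommGroup E] [NormedSpace ℝ E] [FiniteDimensional ℝ E]
  {Mb : Type*} [TopologicalSpace Mb] [ChartedSpace E Mb] [IsManifold 𝓘(ℝ, E) ∞ Mb]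
  [RiemannianBundle (fun p : Mb => TangentSpace 𝓘(ℝ, E) p)]
  {F : Type*} [NormedAddCommGroup F] [NormedSpace ℝ F]
  {M : Type*} [TopologicalSpace M] [ChartedSpace F M] [IsManifold 𝓘(ℝ, F) ∞ M]
  {ι : M → Mb} {φ : ∀ p : Mb, TangentSpace 𝓘(ℝ, E) p →L[ℝ] TangentSpace 𝓘(ℝ, E) p} {ε : ℝ}
  {k : ℕ} {D : Fin (k + 1) → ∀ x : M, Submodule ℝ (TangentSpace 𝓘(ℝ, F) x)} {U : Set M}

/-- Orthogonality of `Δ` to `ξ` removes the `η ⊗ ξ` term, so the two kinds of structure need no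
separate treatment afterwards. -/
theorem StructureCondition.apply_apply {Δ : ∀ x : M, Submodule ℝ (TangentSpace 𝓘(ℝ, F) x)}
    (h : StructureCondition ε φ ι Δ) (x : M) :
    ∀ v ∈ pushSub E ι x (Δ x), φ (ι x) (φ (ι x) v) = ε • v := by
  rintro _ ⟨v, hv, rfl⟩
  rcases h with h | ⟨ξ, -, -, h, -, ho⟩
  · exact h _ _
  · have h0 := ho x v hv
    rw [real_inner_comm] at h0
    refine (h _ _).trans ?_
    erw [h0]
    rw [zero_smul, sub_zero]

theorem IsDecompositionOn.inner_eq_zero (h : IsDecompositionOn φ ι U D) {x : M} (hx : x ∈ U)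
    {i j : Fin (k + 1)} (hij : i ≠ j) : ∀ v ∈ pushSub E ι x (D i x),
      ∀ w ∈ pushSub E ι x (D j x), ⟪v, w⟫_ℝ = 0 := by
  rintro _ ⟨v, hv, rfl⟩ _ ⟨w, hw, rfl⟩
  exact h.orthogonal i j hij x hx v hv w hw

theorem IsDecompositionOn.projComp_mem (h : IsDecompositionOn φ ι U D) {x : M} (hx : x ∈ U)
    (i : Fin k) : ∀ v ∈ pushSub E ι x (D i.succ x),
      projComp (φ (ι x)) (pushSub E ι x (total D x)) v ∈ pushSub E ι x (D i.succ x) := by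
  rintro _ ⟨v, hv, rfl⟩
  exact h.component i x hx v hv

theorem IsDecompositionOn.ne_bot (h : IsDecompositionOn φ ι U D) {x : M} (hx : x ∈ U)
    (i : Fin k) : D i.succ x ≠ ⊥ :=
  (h.regular i.succ).ne_bot (h.nonNull i) hx

theorem IsDecompositionOn.exists_ne_zero
    (hι' : ∀ x, Function.Injective (mfderiv 𝓘(ℝ, F) 𝓘(ℝ, E) ι x))
    (h : IsDecompositionOn φ ι U D) {x : M} (hx : x ∈ U)
    (i : Fin k) : ∃ v ∈ D i.succ x, v ≠ 0 ∧ push E ι x v ≠ 0 := by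
  obtain ⟨v, hv, hv0⟩ := Submodule.exists_mem_ne_zero_of_ne_bot (h.ne_bot hx i)
  exact ⟨v, hv, hv0, fun h0 => hv0 (hι' x (h0.trans (map_zero (push E ι x)).symm))⟩

theorem IsDecompositionOn.projComp_sq (hε : ε * ε = 1)
    (hφε : ∀ (p : Mb) (v w : TangentSpace 𝓘(ℝ, E) p), ⟪φ p v, w⟫_ℝ = ε * ⟪v, φ p w⟫_ℝ)
    (h : IsDecompositionOn φ ι U D) {x : M} (hx : x ∈ U)
    (hsq : ∀ v ∈ pushSub E ι x (total D x), φ (ι x) (φ (ι x) v) = ε • v) (i : Fin k) {t : ℝ}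
    (ht : ∀ v ∈ D i.succ x, v ≠ 0 →
      angleSubspace (φ (ι x) (push E ι x v)) (pushSub E ι x (D i.succ x)) = t)
    {v : TangentSpace 𝓘(ℝ, E) (ι x)} (hv : v ∈ pushSub E ι x (D i.succ x)) :
    projComp (φ (ι x)) (pushSub E ι x (total D x))
      (projComp (φ (ι x)) (pushSub E ι x (total D x)) v) = (ε * Real.cos t ^ 2) • v := by
  refine projComp_sq_of_slant (hφε (ι x)) hε hsq (pushSub_mono (le_total D i.succ x))
    (h.projComp_mem hx i) ?_ hv
  rintro _ ⟨w, hw, rfl⟩ hw0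
  exact ht w hw fun h0 => hw0 (by rw [h0, map_zero])

/-- The eigenvalues of `f²` other than `ε` are determined by the slant angles. -/
theorem IsDecompositionOn.eigenvalues_eq_range (hε : ε * ε = 1)
    (hι' : ∀ x, Function.Injective (mfderiv 𝓘(ℝ, F) 𝓘(ℝ, E) ι x))
    (hφε : ∀ (p : Mb) (v w : TangentSpace 𝓘(ℝ, E) p), ⟪φ p v, w⟫_ℝ = ε * ⟪v, φ p w⟫_ℝ)
    (h : IsDecompositionOn φ ι U D) {x : M} (hx : x ∈ U)
    (hsq : ∀ v ∈ pushSub E ι x (total D x), φ (ι x) (φ (ι x) v) = ε • v) {t : Fin k → ℝ}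
    (ht : ∀ i, t i ∈ Set.Ioc 0 (Real.pi / 2) ∧ ∀ v ∈ D i.succ x, v ≠ 0 →
      φ (ι x) (push E ι x v) ≠ 0 ∧
      angleSubspace (φ (ι x) (push E ι x v)) (pushSub E ι x (D i.succ x)) = t i) :
    {c : ℝ | c ≠ ε ∧ ∃ v ∈ pushSub E ι x (total D x), v ≠ 0 ∧
      projComp (φ (ι x)) (pushSub E ι x (total D x))
        (projComp (φ (ι x)) (pushSub E ι x (total D x)) v) = c • v} =
      Set.range fun i => ε * Real.cos (t i) ^ 2 := by
  have hB : ∀ (i : Fin k), ∀ v ∈ pushSub E ι x (D i.succ x), _ := fun i v hv =>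
    h.projComp_sq hε hφε hx hsq i (fun v hv h0 => ((ht i).2 v hv h0).2) hv
  ext c
  constructor
  · rintro ⟨hc, v, hv, hv0, hvc⟩
    rw [pushSub_total] at hv
    obtain ⟨j, hj⟩ := exists_eq_of_eigenvector
      (fun i j hij => h.inner_eq_zero hx hij)
      (projComp (φ (ι x)) (pushSub E ι x (total D x)) ∘L
        projComp (φ (ι x)) (pushSub E ι x (total D x)))
      -- The eigenvalue `ε` belongs to the invariant component `D 0`.
      (Fin.cons ε fun i => ε * Real.cos (t i) ^ 2)
      (fun j => by
        refine Fin.cases (fun v hv => ?_) (fun i v hv => ?_) j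
        · refine projComp_sq_of_invariant hsq (pushSub_mono (le_total D 0 x)) ?_ hv
          rintro _ ⟨w, hw, rfl⟩
          exact h.invariant x hx w hw
        · exact hB i v hv) hv hv0 hvc
    revert hj
    refine Fin.cases (fun hj => absurd hj hc) (fun i hj => ⟨i, hj.symm⟩) j
  · rintro ⟨i, rfl⟩
    refine ⟨mul_cos_sq_ne hε (ht i).1, ?_⟩
    obtain ⟨v, hv, -, hv0⟩ := h.exists_ne_zero hι' hx i
    exact ⟨_, push_mem_pushSub (le_total D i.succ x hv), hv0, hB i _ (push_mem_pushSub hv)⟩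

/-- Where the slant functions are constant, the components with equal slant angles can be grouped
together to give a slant distribution. -/
theorem IsKPointwiseSlant.exists_isKSlantOn (hε : ε * ε = 1)
    (hι' : ∀ x, Function.Injective (mfderiv 𝓘(ℝ, F) 𝓘(ℝ, E) ι x))
    (hφε : ∀ (p : Mb) (v w : TangentSpace 𝓘(ℝ, E) p), ⟪φ p v, w⟫_ℝ = ε * ⟪v, φ p w⟫_ℝ)
    {θ : Fin k → M → ℝ} (hD : IsKPointwiseSlant φ ι D θ)
    (hsq : ∀ x, ∀ v ∈ pushSub E ι x (total D x), φ (ι x) (φ (ι x) v) = ε • v)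
    (hU : IsOpen U) {x₀ : M} (hx₀ : x₀ ∈ U) (hθ : ∀ i, ∀ y ∈ U, θ i y = θ i x₀) :
    ∃ k' ≤ k, IsKSlantOn φ ι U k' (total D) := by
  classical
  have hdec := hD.decomposition
  -- The distinct angles at `x₀`; `G j` collects the components sharing the `j`-th of them.
  set S : Finset ℝ := Finset.univ.image fun i => θ i x₀
  let e : Fin S.card ≃ S := S.equivFin.symm
  let G : Fin S.card → ∀ x : M, Submodule ℝ (TangentSpace 𝓘(ℝ, F) x) := fun j x =>
    ⨆ i : {i : Fin k // θ i x₀ = e j}, D i.1.succ x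
  let D' : Fin (S.card + 1) → ∀ x : M, Submodule ℝ (TangentSpace 𝓘(ℝ, F) x) := Fin.cons (D 0) G
  have hex : ∀ j, ∃ i, θ i x₀ = e j := fun j => by
    obtain ⟨i, -, hi⟩ := Finset.mem_image.1 (e j).2
    exact ⟨i, hi⟩
  have htot : ∀ x, total D' x = total D x := by
    intro x
    apply le_antisymm
    · refine iSup_le fun j => ?_
      refine Fin.cases ?_ (fun j => ?_) j
      · exact le_total D 0 x
      · exact iSup_le fun i => le_total D i.1.succ x
    · refine iSup_le fun i => ?_
      refine Fin.cases ?_ (fun i => ?_) i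
      · exact le_total D' 0 x
      · have hi : θ i x₀ ∈ S := Finset.mem_image_of_mem _ (Finset.mem_univ i)
        refine le_trans ?_ (le_total D' (e.symm ⟨_, hi⟩).succ x)
        exact le_iSup (fun i : {i' : Fin k // θ i' x₀ = e (e.symm ⟨_, hi⟩)} => D i.1.succ x)
          ⟨i, by simp⟩
  have hGle : ∀ j x (P : Submodule ℝ (TangentSpace 𝓘(ℝ, F) x)),
      (∀ i, θ i x₀ = e j → D i.succ x ≤ P) → G j x ≤ P := fun j x P h =>
    iSup_le fun i => h i.1 i.2
  have hcomp : ∀ j, ∀ x ∈ U, ∀ v ∈ pushSub E ι x (G j x),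
      projComp (φ (ι x)) (pushSub E ι x (total D x)) v ∈ pushSub E ι x (G j x) := by
    rintro j x - _ ⟨v, hv, rfl⟩
    refine hGle j x ((pushSub E ι x (G j x)).comap
      ((projComp (φ (ι x)) (pushSub E ι x (total D x))).toLinearMap ∘ₗ
        (push E ι x).toLinearMap)) (fun i hi w hw => ?_) hv
    exact pushSub_mono (le_iSup (fun i : {i : Fin k // θ i x₀ = e j} => D i.1.succ x) ⟨i, hi⟩)
      (hdec.projComp_mem trivial i _ (push_mem_pushSub hw))
  -- Orthogonality is phrased as an inclusion of subspaces, so that it passes to the suprema `G j`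
  -- through `hGle`.
  have hort : ∀ (x : M) (P Q : Submodule ℝ (TangentSpace 𝓘(ℝ, F) x)),
      (∀ v ∈ P, ∀ w ∈ Q, ⟪push E ι x v, push E ι x w⟫_ℝ = 0) ↔
        P ≤ (pushSub E ι x Q)ᗮ.comap (push E ι x).toLinearMap := by
    intro x P Q
    constructor
    · intro h v hv
      rw [Submodule.mem_comap, Submodule.mem_orthogonal']
      rintro _ ⟨w, hw, rfl⟩
      exact h v hv w hw
    · intro h v hv w hw
      exact (Submodule.mem_orthogonal' _ _).1 (h hv) _ (push_mem_pushSub hw)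
  have hGD : ∀ j m, (∀ i, θ i x₀ = e j → i.succ ≠ m) → ∀ x, ∀ v ∈ G j x, ∀ w ∈ D m x,
      ⟪push E ι x v, push E ι x w⟫_ℝ = 0 := by
    intro j m hm x
    rw [hort]
    exact hGle j x _ fun i hi =>
      (hort _ _ _).1 (hdec.orthogonal i.succ m (hm i hi) x trivial)
  have hG0 : ∀ j, ∀ x, ∀ v ∈ G j x, ∀ w ∈ D 0 x, ⟪push E ι x v, push E ι x w⟫_ℝ = 0 :=
    fun j => hGD j 0 fun i _ => Fin.succ_ne_zero i
  have hGG : ∀ i j, i ≠ j → ∀ x, ∀ v ∈ G i x, ∀ w ∈ G j x,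
      ⟪push E ι x v, push E ι x w⟫_ℝ = 0 := by
    intro i j hij x
    rw [hort]
    refine hGle i x _ fun m hm => (hort _ _ _).1 fun v hv w hw => ?_
    rw [real_inner_comm]
    refine hGD j m.succ (fun l hl h => hij ?_) x w hw v hv
    rw [Fin.succ_injective _ h, hm] at hl
    exact e.injective (Subtype.ext hl)
  refine ⟨S.card, Finset.card_image_le.trans (by simp), ?_, D', fun j => e j, fun x _ => htot x,
    ⟨?_, ?_, ?_, ?_, ?_⟩, fun j => ⟨?_, ?_⟩, ?_⟩
  · exact Finset.card_pos.2 ⟨θ ⟨0, hD.pos⟩ x₀, Finset.mem_image_of_mem _ (Finset.mem_univ _)⟩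
  · refine Fin.cases ((hdec.regular 0).mono hU (Set.subset_univ U)) fun j => ?_
    exact IsRegularDistributionOn.iSup hU hι'
      (fun i => (hdec.regular i.1.succ).mono hU (Set.subset_univ U))
      fun i i' hii x _ => hdec.orthogonal _ _
        (fun h => hii (Subtype.ext (Fin.succ_injective _ h))) x trivial
  · intro j
    obtain ⟨i, hi⟩ := hex j
    refine ⟨x₀, hx₀, fun h0 => hdec.ne_bot (x := x₀) trivial i ?_⟩
    rw [eq_bot_iff, ← h0]
    exact le_iSup (fun i : {i : Fin k // θ i x₀ = e j} => D i.1.succ x₀) ⟨i, hi⟩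
  · intro i j
    refine Fin.cases ?_ (fun i => ?_) i <;> refine Fin.cases ?_ (fun j => ?_) j
    · exact fun h => absurd rfl h
    · intro _ x _ v hv w hw
      rw [real_inner_comm]
      exact hG0 j x w hw v hv
    · exact fun _ x _ => hG0 i x
    · exact fun h x _ => hGG i j (fun h' => h (congrArg _ h')) x
  · exact fun x _ => hdec.invariant x trivial
  · intro j x hx v hv
    rw [comp_eq_projComp, htot]
    exact hcomp j x hx _ (push_mem_pushSub hv)
  · obtain ⟨i, hi⟩ := hex j
    exact (hi ▸ ((hD.slant i).2 x₀ trivial).1 : (e j : ℝ) ∈ Set.Ioc 0 (Real.pi / 2))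
  · intro x hx v hv hv0
    obtain ⟨i, hi⟩ := hex j
    refine slant_of_projComp_sq (hφε (ι x)) hε (hsq x)
      (pushSub_mono ((le_total D' j.succ x).trans (htot x).le)) (hcomp j x hx)
      (hi ▸ ((hD.slant i).2 x₀ trivial).1 : (e j : ℝ) ∈ Set.Ioc 0 (Real.pi / 2)) ?_ (push_mem_pushSub hv)
      fun h0 => hv0 (hι' x (h0.trans (map_zero (push E ι x)).symm))
    rintro _ ⟨w, hw, rfl⟩
    -- The vectors satisfying the eigenvalue equation form a subspace, so it suffices to check the
    -- merged components.
    have h1 : G j x ≤ LinearMap.eqLocus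
      ((projComp (φ (ι x)) (pushSub E ι x (total D x)) ∘L
        projComp (φ (ι x)) (pushSub E ι x (total D x))).toLinearMap ∘ₗ (push E ι x).toLinearMap)
      ((ε * Real.cos (e j) ^ 2) • (push E ι x).toLinearMap) := by
      refine hGle j x _ fun i hi w hw => ?_
      have h2 := hdec.projComp_sq hε hφε trivial (hsq x) i
        (fun v hv h0 => (((hD.slant i).2 x trivial).2 v hv h0).2) (push_mem_pushSub hw)
      rw [hθ i x hx, hi] at h2
      exact h2
    exact h1 hw
  · exact Subtype.val_injective.comp e.injective

end Slant

/-! ### The covariant derivative of `f²` -/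

section Parallel

open Filter Topology

variable {E : Type*} [NormedAddCommGroup E] [NormedSpace ℝ E] [FiniteDimensional ℝ E]
  {Mb : Type*} [TopologicalSpace Mb] [ChartedSpace E Mb] [IsManifold 𝓘(ℝ, E) ∞ Mb]
  [RiemannianBundle (fun p : Mb => TangentSpace 𝓘(ℝ, E) p)]
  [IsContMDiffRiemannianBundle 𝓘(ℝ, E) ∞ E (fun p : Mb => TangentSpace 𝓘(ℝ, E) p)]
  {F : Type*} [NormedAddCommGroup F] [NormedSpace ℝ F] [FiniteDimensional ℝ F]
  {M : Type*} [TopologicalSpace M] [ChartedSpace F M] [IsManifold 𝓘(ℝ, F) ∞ M] [T2Space M]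
  {ι : M → Mb} {φ : ∀ p : Mb, TangentSpace 𝓘(ℝ, E) p →L[ℝ] TangentSpace 𝓘(ℝ, E) p} {ε : ℝ}
  {k : ℕ} {D : Fin (k + 1) → ∀ x : M, Submodule ℝ (TangentSpace 𝓘(ℝ, F) x)}
  {μ : Fin k → M → ℝ}

theorem SmoothField.smoothAlongAt_push (hι : ContMDiff 𝓘(ℝ, F) 𝓘(ℝ, E) ∞ ι)
    {X : ∀ x : M, TangentSpace 𝓘(ℝ, F) x} (hX : SmoothField X) (x : M) :
    SmoothAlongAt F ι (fun y => push E ι y (X y)) x :=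
  KSlant.smoothAlongAt_push hι (SmoothFieldOn.contMDiffAt isOpen_univ hX trivial)

/-- A regular distribution that does not vanish at `x` has a global smooth section that does not
vanish at `x`. -/
theorem IsRegularDistributionOn.exists_smoothField_ne_zero
    {Δ : ∀ x : M, Submodule ℝ (TangentSpace 𝓘(ℝ, F) x)}
    (hΔ : IsRegularDistributionOn Set.univ Δ) {x : M} (h0 : Δ x ≠ ⊥) :
    ∃ Y : ∀ x : M, TangentSpace 𝓘(ℝ, F) x, SmoothField Y ∧ (∀ y, Y y ∈ Δ y) ∧ Y x ≠ 0 := by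
  obtain ⟨r, hr⟩ := hΔ
  obtain ⟨N, hN, hxN, -, V, hV, hs⟩ := hr x trivial
  rcases r with _ | r
  · refine absurd ?_ h0
    rw [← (hs x hxN).2, Set.range_eq_empty, Submodule.span_empty]
  · obtain ⟨b, hb, hbN, hY⟩ := exists_cutoff hN hxN (hV 0)
    refine ⟨_, hY, fun y => ?_, ?_⟩
    · by_cases hy : y ∈ N
      · rw [← (hs y hy).2]
        exact Submodule.smul_mem _ _ (Submodule.subset_span ⟨0, rfl⟩)
      · simp only [hbN y hy, zero_smul, Submodule.zero_mem]
    · simp only [hb, one_smul]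
      exact (hs x hxN).1.ne_zero 0

/-- The eigenvalue functions of `f²` are smooth. -/
theorem AreEigenvalueFunctions.contMDiffAt (hι : ContMDiff 𝓘(ℝ, F) 𝓘(ℝ, E) ∞ ι)
    (hι' : ∀ x, Function.Injective (mfderiv 𝓘(ℝ, F) 𝓘(ℝ, E) ι x))
    (hφ : ContMDiff 𝓘(ℝ, E) (𝓘(ℝ, E).prod 𝓘(ℝ, E →L[ℝ] E)) ∞
      (fun p => TotalSpace.mk' (E →L[ℝ] E)
        (E := fun p : Mb => TangentSpace 𝓘(ℝ, E) p →L[ℝ] TangentSpace 𝓘(ℝ, E) p) p (φ p)))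
    (hdec : IsDecompositionOn φ ι Set.univ D) (hμ : AreEigenvalueFunctions φ ι D μ) (i : Fin k)
    (x : M) : ContMDiffAt 𝓘(ℝ, F) 𝓘(ℝ, ℝ) ∞ (μ i) x := by
  have hreg := hdec.regular i.succ
  obtain ⟨Y, hY, hYD, hY0⟩ := hreg.exists_smoothField_ne_zero (hdec.ne_bot (x := x) trivial i)
  have hf : ∀ {Z : ∀ x : M, TangentSpace 𝓘(ℝ, E) (ι x)},
      (∀ y, Z y ∈ pushSub E ι y (D i.succ y)) → SmoothAlongAt F ι Z x →
      SmoothAlongAt F ι (fun y => comp φ ι (total D) y (Z y)) x := by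
    intro Z hZD hZ
    -- On `Dᵢ` the map `f` is also `φ` followed by projection onto the regular `Dᵢ`, so smoothness
    -- of the projection onto the total distribution is not needed.
    refine (hreg.smoothAlongAt_projection hι hι' (hZ.clm_apply hφ)).congr
      (Eventually.of_forall fun y => ?_)
    exact (starProjection_eq_projComp (pushSub_mono (le_total D i.succ y))
      (hdec.projComp_mem trivial i _ (hZD y))).symm
  have hpY : ∀ y, push E ι y (Y y) ∈ pushSub E ι y (D i.succ y) := fun y =>
    push_mem_pushSub (hYD y)
  have hYs := hY.smoothAlongAt_push hι x
  refine contMDiffAt_of_smul_eq hYs (hf (fun y => hdec.projComp_mem trivial i _ (hpY y))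
    (hf hpY hYs)) (fun h0 => hY0 (hι' x (h0.trans (map_zero (push E ι x)).symm)))
    (Eventually.of_forall fun y => (hμ i y).2 _ (hYD y))

/-- The Leibniz rule for `f² Y = λᵢ Y`. -/
theorem nablaSq_eq_of_mem (hι : ContMDiff 𝓘(ℝ, F) 𝓘(ℝ, E) ∞ ι)
    (hμ : AreEigenvalueFunctions φ ι D μ) {i : Fin k} {X Y : ∀ x : M, TangentSpace 𝓘(ℝ, F) x}
    (hY : SmoothField Y) (hYD : ∀ y, Y y ∈ D i.succ y) {x : M} {C : F →L[ℝ] ℝ}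
    (hC : HasMFDerivAt 𝓘(ℝ, F) 𝓘(ℝ, ℝ) (μ i) x C) :
    nablaSq φ ι (total D) X Y x =
      C (X x) • push E ι x (Y x) + μ i x • nabla E ι X Y x -
        comp φ ι (total D) x (comp φ ι (total D) x (nabla E ι X Y x)) := by
  unfold nablaSq
  rw [covDerivAlong_congr (V := fun y => μ i y • push E ι y (Y y))
    (Eventually.of_forall fun y => (hμ i y).2 _ (hYD y)),
    covDerivAlong_smul hC (hY.smoothAlongAt_push hι x)]
  rfl

theorem NablaSqVanishes.mfderiv_eq_zero (hε : ε * ε = 1) (hι : ContMDiff 𝓘(ℝ, F) 𝓘(ℝ, E) ∞ ι)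
    (hι' : ∀ x, Function.Injective (mfderiv 𝓘(ℝ, F) 𝓘(ℝ, E) ι x))
    (hφε : ∀ (p : Mb) (v w : TangentSpace 𝓘(ℝ, E) p), ⟪φ p v, w⟫_ℝ = ε * ⟪v, φ p w⟫_ℝ)
    (hdec : IsDecompositionOn φ ι Set.univ D) (hμ : AreEigenvalueFunctions φ ι D μ)
    (hnabla : NablaPreserves E ι D) (hvan : NablaSqVanishes φ ι D) {i : Fin k} {x : M}
    {C : F →L[ℝ] ℝ} (hC : HasMFDerivAt 𝓘(ℝ, F) 𝓘(ℝ, ℝ) (μ i) x C) : C = 0 := by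
  obtain ⟨Y, hY, hYD, hY0⟩ :=
    (hdec.regular i.succ).exists_smoothField_ne_zero (hdec.ne_bot (x := x) trivial i)
  have hYp : ∀ y, Y y ∈ proper D y := fun y => le_proper D i y (hYD y)
  have hpY0 : push E ι x (Y x) ≠ 0 := fun h0 =>
    hY0 (hι' x (h0.trans (map_zero (push E ι x)).symm))
  ext a
  obtain ⟨X, hX, hXa⟩ := exists_smoothField_apply_eq x (a : TangentSpace 𝓘(ℝ, F) x)
  have h1 := nablaSq_eq_of_mem (X := X) hι hμ hY hYD hC
  rw [hvan X Y hX hY hYp x, eq_comm, sub_eq_zero] at h1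
  -- Pairing with `Y`: by `h3`, self-adjointness of `f²` on `D`, the terms in `∇_X Y` cancel and `C
  -- (X x) ‖Y‖² = 0` is left.
  have h2 := congrArg (fun u => ⟪u, push E ι x (Y x)⟫_ℝ) h1
  have h3 := projComp_sq_symm (hφε (ι x)) hε (hnabla X Y hX hY hYp x)
    (push_mem_pushSub (E := E) (ι := ι) (le_total D i.succ x (hYD x)))
  have h4 : projComp (φ (ι x)) (pushSub E ι x (total D x)) (projComp (φ (ι x))
    (pushSub E ι x (total D x)) (push E ι x (Y x))) = _ := (hμ i x).2 _ (hYD x)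
  rw [h4, inner_smul_right] at h3
  simp only [comp_eq_projComp, h3, inner_add_left, inner_smul_left, conj_trivial] at h2
  have h5 := (mul_eq_zero.1 (add_eq_right.1 h2)).resolve_right (inner_self_ne_zero.2 hpY0)
  rw [hXa] at h5
  exact h5

theorem NablaSqVanishes.nablaEigen (hι : ContMDiff 𝓘(ℝ, F) 𝓘(ℝ, E) ∞ ι)
    (hμ : AreEigenvalueFunctions φ ι D μ)
    (hC : ∀ i x, HasMFDerivAt 𝓘(ℝ, F) 𝓘(ℝ, ℝ) (μ i) x (0 : F →L[ℝ] ℝ))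
    (hvan : NablaSqVanishes φ ι D) : NablaEigen φ ι D μ := by
  intro i X Y hX hY hYD x
  have h1 := nablaSq_eq_of_mem (X := X) hι hμ hY hYD (hC i x)
  rw [hvan X Y hX hY (fun y => le_proper D i y (hYD y)) x, eq_comm, sub_eq_zero] at h1
  rw [← h1]
  refine add_eq_right.2 ?_
  exact zero_smul ℝ _

theorem NablaEigen.nablaSqVanishes (hι : ContMDiff 𝓘(ℝ, F) 𝓘(ℝ, E) ∞ ι)
    (hι' : ∀ x, Function.Injective (mfderiv 𝓘(ℝ, F) 𝓘(ℝ, E) ι x))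
    (hdec : IsDecompositionOn φ ι Set.univ D) (hμ : AreEigenvalueFunctions φ ι D μ)
    (hμs : ∀ i x, ContMDiffAt 𝓘(ℝ, F) 𝓘(ℝ, ℝ) ∞ (μ i) x)
    (hC : ∀ i x, HasMFDerivAt 𝓘(ℝ, F) 𝓘(ℝ, ℝ) (μ i) x (0 : F →L[ℝ] ℝ))
    (heig : NablaEigen φ ι D μ) : NablaSqVanishes φ ι D := by
  intro X Y hX hY hYp x
  -- `Z i` is the smooth component of `Y` in `Dᵢ`; (i) speaks only of sections of a single `Dᵢ`.
  choose Z hZ hZD using fun i : Fin k => (hdec.regular i.succ).exists_smoothField_projection hι hι'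
    fun x => hY.smoothAlongAt_push hι x
  have hsum : ∀ y, push E ι y (Y y) = ∑ i, push E ι y (Z i y) := by
    intro y
    have h1 : push E ι y (Y y) ∈ ⨆ i : Fin k, pushSub E ι y (D i.succ y) := by
      have := push_mem_pushSub (E := E) (ι := ι) (hYp y)
      unfold pushSub proper at this
      rwa [Submodule.map_iSup] at this
    rw [← sum_starProjection_of_mem_iSup (fun i j hij =>
      hdec.inner_eq_zero trivial fun h => hij (Fin.succ_injective _ h)) h1]
    exact Finset.sum_congr rfl fun i _ => (hZD i y).2
  have hZs : ∀ i, SmoothAlongAt F ι (fun y => push E ι y (Z i y)) x := fun i =>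
    (hZ i).smoothAlongAt_push hι x
  have h1 : nabla E ι X Y x = ∑ i, nabla E ι X (Z i) x := by
    unfold nabla
    rw [covDerivAlong_congr (Eventually.of_forall hsum), covDerivAlong_sum hZs]
  have h2 : ∀ y, comp φ ι (total D) y (comp φ ι (total D) y (push E ι y (Y y))) =
      ∑ i, μ i y • push E ι y (Z i y) := by
    intro y
    simp only [hsum, comp_eq_projComp, map_sum]
    exact Finset.sum_congr rfl fun i _ => (hμ i y).2 _ (hZD i y).1
  unfold nablaSq
  rw [covDerivAlong_congr (Eventually.of_forall h2), 
    covDerivAlong_sum fun i => (hZs i).smul (hμs i x), h1]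
  simp only [comp_eq_projComp, map_sum]
  rw [sub_eq_zero]
  refine Finset.sum_congr rfl fun i _ => ?_
  rw [covDerivAlong_smul (hC i x) (hZs i)]
  refine Eq.trans ?_ (heig i X (Z i) hX (hZ i) (fun y => (hZD i y).1) x).symm
  refine add_eq_right.2 ?_
  exact zero_smul ℝ _

end Parallel

end KSlant

end

/-! ### The theorem -/

theorem theoremp169
    {E : Type*} [NormedAddCommGroup E] [NormedSpace ℝ E] [FiniteDimensional ℝ E]
    {Mb : Type*} [TopologicalSpace Mb] [ChartedSpace E Mb] [IsManifold 𝓘(ℝ, E) ∞ Mb] [T2Space Mb]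
    [RiemannianBundle (fun p : Mb => TangentSpace 𝓘(ℝ, E) p)]
    [IsContMDiffRiemannianBundle 𝓘(ℝ, E) ∞ E (fun p : Mb => TangentSpace 𝓘(ℝ, E) p)]
    {F : Type*} [NormedAddCommGroup F] [NormedSpace ℝ F] [FiniteDimensional ℝ F]
    {M : Type*} [TopologicalSpace M] [ChartedSpace F M] [IsManifold 𝓘(ℝ, F) ∞ M] [T2Space M]
    (ι : M → Mb) (hι : ContMDiff 𝓘(ℝ, F) 𝓘(ℝ, E) ∞ ι)
    (hι' : ∀ x, Function.Injective (mfderiv 𝓘(ℝ, F) 𝓘(ℝ, E) ι x))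
    (ε : ℝ) (hε : ε = 1 ∨ ε = -1)
    (φ : ∀ p : Mb, TangentSpace 𝓘(ℝ, E) p →L[ℝ] TangentSpace 𝓘(ℝ, E) p)
    (hφ : ContMDiff 𝓘(ℝ, E) (𝓘(ℝ, E).prod 𝓘(ℝ, E →L[ℝ] E)) ∞
      (fun p => TotalSpace.mk' (E →L[ℝ] E)
        (E := fun p : Mb => TangentSpace 𝓘(ℝ, E) p →L[ℝ] TangentSpace 𝓘(ℝ, E) p) p (φ p)))
    (hφε : ∀ (p : Mb) (v w : TangentSpace 𝓘(ℝ, E) p), ⟪φ p v, w⟫_ℝ = ε * ⟪v, φ p w⟫_ℝ)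
    (k : ℕ) (D : Fin (k + 1) → ∀ x : M, Submodule ℝ (TangentSpace 𝓘(ℝ, F) x))
    (θ : Fin k → M → ℝ)
    (hstr : KSlant.StructureCondition ε φ ι (KSlant.total D))
    (hD : KSlant.IsKPointwiseSlant φ ι D θ)
    (hnabla : KSlant.NablaPreserves E ι D) :
    ∃ μ : Fin k → M → ℝ, KSlant.AreEigenvalueFunctions φ ι D μ ∧
      -- arbitrary `M`
      ((KSlant.NablaSqVanishes φ ι D ↔
          KSlant.NablaEigen φ ι D μ ∧
          ∀ x : M, ∃ k' ≤ k, KSlant.IsKSlantOn φ ι (connectedComponent x) k' (KSlant.total D)) ∧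
        (∀ x : M,
          ((∃ k' ≤ k, KSlant.IsKSlantOn φ ι (connectedComponent x) k' (KSlant.total D)) ↔
            ∀ i, ∃ c : ℝ, ∀ y ∈ connectedComponent x, μ i y = c)) ∧
        (∀ (x : M) (k' : ℕ),
          KSlant.IsKSlantOn φ ι (connectedComponent x) k' (KSlant.total D) →
            k' = (Set.range fun i => μ i x).ncard)) ∧
      -- connected `M`
      (ConnectedSpace M →
        (KSlant.NablaSqVanishes φ ι D ↔
          KSlant.NablaEigen φ ι D μ ∧ KSlant.IsKSlantOn φ ι Set.univ k (KSlant.total D)) ∧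
        (KSlant.IsKSlantOn φ ι Set.univ k (KSlant.total D) ↔
          (∀ i, ∃ c : ℝ, ∀ x, μ i x = c) ∧ ∀ i j, i ≠ j → ∀ x, μ i x ≠ μ j x)) := by
  have hεε : ε * ε = 1 := by rcases hε with rfl | rfl <;> norm_num
  have hsq := hstr.apply_apply
  have hdec := hD.decomposition
  set μ : Fin k → M → ℝ := fun i x => ε * Real.cos (θ i x) ^ 2
  have hinj := KSlant.mul_cos_sq_injOn hεε
  have hθ := fun (i : Fin k) (x : M) => (hD.slant i).2 x trivial
  have hμθ : ∀ {i j x y}, μ i x = μ j y → θ i x = θ j y := fun {i j x y} h =>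
    hinj (hθ i x).1 (hθ j y).1 h
  have hμ : KSlant.AreEigenvalueFunctions φ ι D μ := by
    intro i x
    have h := fun v (hv : v ∈ D i.succ x) => hdec.projComp_sq hεε hφε trivial (hsq x) i
      (fun v hv h0 => ((hθ i x).2 v hv h0).2) (KSlant.push_mem_pushSub hv)
    refine ⟨fun c => ⟨?_, ?_⟩, h⟩
    · rintro ⟨v, hv, hv0, hc⟩
      refine smul_left_injective ℝ (fun h0 => hv0 (hι' x ?_)) (hc.symm.trans (h v hv))
      exact h0.trans (map_zero (KSlant.push E ι x)).symm
    · rintro rfl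
      obtain ⟨v, hv, hv0, -⟩ := hdec.exists_ne_zero hι' (x := x) trivial i
      exact ⟨v, hv, hv0, h v hv⟩
  have hμs := fun i x => hμ.contMDiffAt hι hι' hφ hdec i x
  have hopen : ∀ x : M, IsOpen (connectedComponent x) := by
    have := ChartedSpace.locallyConnectedSpace F M
    exact fun x => isOpen_connectedComponent
  -- `S` is computed from the slant decomposition, whose angles are constants, so it does not depend
  -- on `y`.
  have hrange : ∀ (x : M) (k' : ℕ),
      KSlant.IsKSlantOn φ ι (connectedComponent x) k' (KSlant.total D) → ∃ S : Set ℝ, S.Finite ∧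
        S.ncard = k' ∧ ∀ y ∈ connectedComponent x, (Set.range fun i => μ i y) = S := by
    rintro x k' ⟨-, D', θ', htot, hdec', hsl, hθ'⟩
    refine ⟨Set.range fun j => ε * Real.cos (θ' j) ^ 2, Set.finite_range _, ?_, fun y hy => ?_⟩
    · rw [← Set.image_univ, Set.ncard_image_of_injective, Set.ncard_univ, Nat.card_fin]
      exact fun i j h => hθ' (hinj (hsl i).1 (hsl j).1 h)
    · rw [← hdec.eigenvalues_eq_range hεε hι' hφε (x := y) trivial (hsq y) fun i => hθ i y,
        ← htot y hy]
      exact hdec'.eigenvalues_eq_range hεε hι' hφε hy (by rw [htot y hy]; exact hsq y)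
        fun j => ⟨(hsl j).1, (hsl j).2 y hy⟩
  have hconst : ∀ x : M,
      (∃ k' ≤ k, KSlant.IsKSlantOn φ ι (connectedComponent x) k' (KSlant.total D)) ↔
        ∀ i, ∃ c : ℝ, ∀ y ∈ connectedComponent x, μ i y = c := by
    intro x
    constructor
    · rintro ⟨k', -, h⟩ i
      obtain ⟨S, hS, -, hy⟩ := hrange x k' h
      refine ⟨μ i x, fun y hyx => ?_⟩
      -- A continuous function from a connected set to a finite, hence discrete, set is constant.
      exact isPreconnected_connectedComponent.constant_of_mapsTo hS.isDiscrete
        (fun y _ => (hμs i y).continuousAt.continuousWithinAt)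
        (fun y hyx => hy y hyx ▸ ⟨i, rfl⟩) hyx mem_connectedComponent
    · intro h
      refine hD.exists_isKSlantOn hεε hι' hφε hsq (hopen x) mem_connectedComponent fun i y hy => ?_
      obtain ⟨c, hc⟩ := h i
      exact hμθ ((hc y hy).trans (hc x mem_connectedComponent).symm)
  have hncard : ∀ (x : M) (k' : ℕ),
      KSlant.IsKSlantOn φ ι (connectedComponent x) k' (KSlant.total D) →
        k' = (Set.range fun i => μ i x).ncard := by
    intro x k' h
    obtain ⟨S, -, hS, hy⟩ := hrange x k' h
    rw [hy x mem_connectedComponent, hS]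
  have hder : ∀ i x, MDifferentiableAt 𝓘(ℝ, F) 𝓘(ℝ, ℝ) (μ i) x := fun i x =>
    (hμs i x).mdifferentiableAt (by simp)
  have hA : KSlant.NablaSqVanishes φ ι D ↔ KSlant.NablaEigen φ ι D μ ∧
      ∀ x : M, ∃ k' ≤ k, KSlant.IsKSlantOn φ ι (connectedComponent x) k' (KSlant.total D) := by
    simp only [hconst]
    constructor
    · intro h
      have h0 : ∀ i x, mfderiv 𝓘(ℝ, F) 𝓘(ℝ, ℝ) (μ i) x = 0 := fun i x =>
        h.mfderiv_eq_zero hεε hι hι' hφε hdec hμ hnabla (hder i x).hasMFDerivAt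
      refine ⟨h.nablaEigen hι hμ fun i x => ?_, fun x i => ⟨μ i x, fun y hy => ?_⟩⟩
      · have := (hder i x).hasMFDerivAt
        rwa [h0] at this
      · exact KSlant.eqOn_connectedComponent_of_mfderiv_eq_zero (hder i) (h0 i) hy
    · rintro ⟨h, hc⟩
      refine h.nablaSqVanishes hι hι' hdec hμ hμs fun i x => ?_
      obtain ⟨c, hc⟩ := hc x i
      refine (hasMFDerivAt_const c x).congr_of_eventuallyEq ?_
      filter_upwards [(hopen x).mem_nhds mem_connectedComponent] with y hy using hc y hy
  have hinjrange : ∀ x, (Set.range fun i => μ i x).ncard = k ↔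
      ∀ i j, i ≠ j → μ i x ≠ μ j x := by
    intro x
    rw [← Set.image_univ]
    have h1 : (Set.univ : Set (Fin k)).ncard = k := by rw [Set.ncard_univ, Nat.card_fin]
    conv_lhs => rhs; rw [← h1]
    rw [Set.ncard_image_iff, Set.injOn_univ]
    exact ⟨fun h i j hij hμ => hij (h hμ), fun h i j hij => by_contra fun hne => h i j hne hij⟩
  refine ⟨μ, hμ, ⟨hA, hconst, hncard⟩, fun hM => ?_⟩
  have hcc : ∀ x : M, connectedComponent x = Set.univ :=
    PreconnectedSpace.connectedComponent_eq_univ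
  obtain ⟨x₀⟩ : Nonempty M := hM.toNonempty
  have hB : KSlant.IsKSlantOn φ ι Set.univ k (KSlant.total D) ↔
      (∀ i, ∃ c : ℝ, ∀ x, μ i x = c) ∧ ∀ i j, i ≠ j → ∀ x, μ i x ≠ μ j x := by
    constructor
    · intro h
      refine ⟨fun i => ?_, fun i j hij x => ?_⟩
      · obtain ⟨c, hc⟩ := (hconst x₀).1 ⟨k, le_rfl, by rwa [hcc]⟩ i
        exact ⟨c, fun x => hc x (by rw [hcc]; trivial)⟩
      · exact (hinjrange x).1 (hncard x k (by rwa [hcc])).symm i j hij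
    · rintro ⟨h1, h2⟩
      obtain ⟨k', -, h⟩ := (hconst x₀).2 fun i => (h1 i).imp fun c hc y _ => hc y
      have hk : k' = k := (hncard x₀ k' h).trans ((hinjrange x₀).2 fun i j hij => h2 i j hij x₀)
      rwa [hcc, hk] at h
  refine ⟨?_, hB⟩
  rw [hA, hB]
  refine and_congr_right fun _ => ?_
  simp only [hconst]
  simp only [hcc]
  constructor
  · intro h
    have hc : ∀ i, ∃ c : ℝ, ∀ x, μ i x = c := fun i => (h x₀ i).imp fun c hc x => hc x trivial
    -- Two constant eigenvalue functions equal at one point are equal everywhere, so the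
    -- corresponding slant functions coincide, against `hD.distinct`.
    refine ⟨hc, fun i j hij x hx => hij (hD.distinct (funext fun y => hμθ ?_))⟩
    obtain ⟨c, hc'⟩ := hc i
    obtain ⟨d, hd⟩ := hc j
    rw [hc', ← hc' x, hx, hd, hd]
  · rintro ⟨h, -⟩ x i
    exact (h i).imp fun c hc y _ => hc y
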